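/- **Setting.** Let $\kappa_{abc}\in\mathbb Z$ ($a,b,c=1,\dots,b_2$) be the symmetric triple intersection numbers of a Calabi–Yau threefold, $(xyz)=\kappa_{abc}x^ay^bz^c$. A charge $\check\gamma=(p^a,q_a)$ consists of $p\in\mathbb Z^{b_2}$ with $p^3>0$, $(rp^2)>0$, $k_ap^a>0$ for all effective divisor classes $r$ and effective curve classes $k$, and of $q$ with $q_a-\frac12\kappa_{abc}p^bp^c\in\mathbb Z$. As usual, the cone of such $p$ is closed under addition and consists of effective classes, and for every $p$ in it the matrix $\kappa_{abc}p^c$ has signature $(1,b_2-1)$. Given $n\ge1$ charges $\check\gamma_i$, put $\kappa_{i,ab}=\kappa_{abc}p_i^c$ with inverse $\kappa_i^{ab}$, $\gamma_{ij}=p_j^aq_{i,a}-p_i^aq_{j,a}$, and on $\mathbb R^{nb_2}$ put $\boldsymbol x\cdot\boldsymbol y=\sum_i\kappa_{i,ab}x_i^ay_i^b$, $v_{ij,k}^a=\delta_{ki}p_j^a-\delta_{kj}p_i^a$, $\mathcal D(\boldsymbol v)=\boldsymbol v\cdot(\boldsymbol x+\frac1{2\pi}\partial_{\boldsymbol x})$.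 *Generalized error functions.* For $k$ independent vectors $\mathcal V=(\boldsymbol v_1,\dots,\boldsymbol v_k)$ spanning a positive definite subspace with orthonormal basis $\mathcal B$, let $\Phi^E_k(\mathcal V;\boldsymbol x)=E_k(\mathcal B\cdot\mathcal V;\mathcal B\cdot\boldsymbol x)$, where $E_k(M;u)=\int_{\mathbb R^k}du'\,e^{-\pi\sum_i(u_i-u'_i)^2}\prod_i\operatorname{sgn}((M^{\rm tr}u')_i)$, $\operatorname{sgn}(0)=0$, $\Phi^E_0=1$. *Trees.* All trees are unrooted, with edges oriented arbitrarily, an edge $e$ going from $s(e)$ to $t(e)$. $\mathbb T^\ell_{n-2m,m}$ is the set of trees with $n-2m$ vertices and $m$ marks distributed over the vertices, where a vertex $v$ with $m_v$ marks carries $1+2m_v$ of the charges $\check\gamma_1,\dots,\check\gamma_n$, each charge being carried by exactly one vertex; $\mathbb T^\ell_k$ is the set of labelled trees with $k$ vertices and no marks. The charge of a vertex is the sum of the charges it carries, and $\gamma_{vw}$, $\boldsymbol v_{vw}$ for vertices are defined by additivity. Removing an edge $e$ from $\mathcal T$ gives two trees $\mathcal T_e^s\ni s(e)$ and $\mathcal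 T_e^t\ni t(e)$; set $\boldsymbol v_e=\sum_{i\in\mathcal T^s_e,\,j\in\mathcal T^t_e}\boldsymbol v_{ij}$, $\Gamma_e=\sum_{i\in\mathcal T^s_e,\,j\in\mathcal T^t_e}\gamma_{ij}$, $\kappa_{\mathcal T}=\prod_e\gamma_{s(e)t(e)}$ and $\Phi^E_{\mathcal T}(\boldsymbol x)=\Phi^E_{|E_{\mathcal T}|}(\{\boldsymbol v_e\};\boldsymbol x)$. The rational numbers $a_{\mathcal T}$ are defined by $a_\bullet=1$ and $a_{\mathcal T}=\frac1{n_{\mathcal T}}\sum_{v}(-1)^{n_v^+}\prod_sa_{\mathcal T_s(v)}$, where $n_{\mathcal T}$ is the number of vertices, $n_v^+$ is the number of edges incoming at $v$ and $\mathcal T_s(v)$ are the trees left after removing $v$. For a vertex with $m$ marks put $$\mathcal D_m=\sum_{\mathcal T\in\mathbb T^\ell_{2m+1}}a_{\mathcal T}\prod_e\mathcal D(\boldsymbol v_{s(e)t(e)}),\qquad \mathcal V_m=\sum_{\mathcal T\in\mathbb T^\ell_{2m+1}}a_{\mathcal T}\,\kappa_{\mathcal T},$$ the trees being labelled by the charges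 of the vertex. The vertex functions are $$\mathcal E_n(\{\check\gamma_i\};\tau_2)=\frac{1}{(\sqrt{2\tau_2})^{n-1}}\,\frac1{n!}\sum_{m=0}^{\lfloor (n-1)/2\rfloor}\ \sum_{\mathcal T\in\mathbb T^\ell_{n-2m,m}}\Big[\prod_{v}\mathcal D_{m_v}\prod_{e}\mathcal D(\boldsymbol v_{s(e)t(e)})\Big]\Phi^E_{\mathcal T}(\boldsymbol x),\qquad x_i^a=\sqrt{2\tau_2}\,\kappa_i^{ab}q_{i,b}.$$ **Statement.** (1) For all charges $\check\gamma_1,\dots,\check\gamma_n$, the limit $\mathcal E^{(0)}_n=\lim_{\tau_2\to\infty}\mathcal E_n(\{\check\gamma_i\};\tau_2)$ exists and $$\mathcal E^{(0)}_n=\frac1{n!}\sum_{m=0}^{\lfloor (n-1)/2\rfloor}\ \sum_{\mathcal T\in\mathbb T^\ell_{n-2m,m}}\Big[\prod_{v}\mathcal V_{m_v}\Big]\kappa_{\mathcal T}\,\mathsf S_{\mathcal T},\qquad \mathsf S_{\mathcal T}=\sum_{\mathcal J\subseteq E_{\mathcal T}}\Phi^E_{\mathcal T_{\mathcal J}}(0)\prod_{e\in\mathcal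 J}\delta_{\Gamma_e}\prod_{e\in E_{\mathcal T}\setminus\mathcal J}\operatorname{sgn}(\Gamma_e),$$ where $\delta_x=1$ if $x=0$ and $\delta_x=0$ otherwise, and $\mathcal T_{\mathcal J}$ is obtained from $\mathcal T$ by contracting the edges not in $\mathcal J$. (2) Let $\mathcal T_1,\mathcal T_2,\mathcal T_3$ be trees with chosen vertices $v_1,v_2,v_3$, and consider the edges $e_1:v_1\to v_2$, $e_2:v_1\to v_3$, $e_3:v_2\to v_3$. Let $\hat{\mathcal T}_1,\hat{\mathcal T}_2,\hat{\mathcal T}_3$ be the trees obtained from $\mathcal T_1\sqcup\mathcal T_2\sqcup\mathcal T_3$ by adding $\{e_1,e_2\}$, $\{e_2,e_3\}$, $\{e_1,e_3\}$ respectively, with charges distributed over the vertices so that each vertex carries at least one, and let $\mathcal T$ be the tree obtained from any of them by contracting the two added edges. Then $\mathsf e_{\mathcal T}=\Phi^E_{\mathcal T}(0)$ satisfies $$\mathsf e_{\hat{\mathcal T}_1}+\mathsf e_{\hat{\mathcal T}_2}-\mathsf e_{\hat{\mathcal T}_3}=-\mathsf e_{\mathcal T}.$$ (3) The formula in (1)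 with $\mathsf S_{\mathcal T}$ replaced by $\prod_{e\in E_{\mathcal T}}\operatorname{sgn}(\Gamma_e)$ is not correct in general: there are an $n\ge 1$, data $\kappa_{abc}$, effective classes as above and charges $\check\gamma_1,\dots,\check\gamma_n$ for which it does not give the limit of $\mathcal E_n$. -/

import Mathlib

namespace D4Completion

noncomputable section

open scoped Classical
open Matrix

/-! ### Intersection data and charges -/

/-- The cubic form `(pqr) = κ_{abc} p^a q^b r^c` of integer classes. -/
def cubic {b : ℕ} (κ : Fin b → Fin b → Fin b → ℤ) (p q r : Fin b → ℤ) : ℤ :=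
  ∑ i, ∑ j, ∑ k, κ i j k * p i * q j * r k

/-- The matrix `κ_{ab} = κ_{abc} p^c`. -/
def kappaMat {b : ℕ} (κ : Fin b → Fin b → Fin b → ℤ) (p : Fin b → ℤ) :
    Matrix (Fin b) (Fin b) ℝ :=
  Matrix.of fun i j => ∑ k, (κ i j k : ℝ) * (p k : ℝ)

/-- The conditions `p³ > 0`, `(r p²) > 0` and `k · p > 0` for all effective divisor classes `r`
and all effective curve classes `k`. -/
def InChargeCone {b : ℕ} (κ : Fin b → Fin b → Fin b → ℤ)
    (effDiv effCurve : Set (Fin b → ℤ)) (p : Fin b → ℤ) : Prop :=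
  0 < cubic κ p p p ∧ (∀ r ∈ effDiv, 0 < cubic κ r p p) ∧ (∀ k ∈ effCurve, 0 < ∑ a, k a * p a)

/-- The part of the geometry of a Calabi-Yau threefold with `b₂ = b` that is used: the symmetric
triple intersection numbers, the effective divisor and curve classes (in dual bases of `H₄` and
`H₂`), and the standard facts that the cone of D4-brane charges (the ample cone) is closed under
addition and consists of effective classes, and that `κ_{abc} p^c` has signature `(1, b - 1)` for
each `p` in it. -/
structure IntersectionData (b : ℕ) where
  κ : Fin b → Fin b → Fin b → ℤ
  κ_swap_left : ∀ i j k, κ i j k = κ j i k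
  κ_swap_right : ∀ i j k, κ i j k = κ i k j
  effDiv : Set (Fin b → ℤ)
  effCurve : Set (Fin b → ℤ)
  cone_add : ∀ p p', InChargeCone κ effDiv effCurve p → InChargeCone κ effDiv effCurve p' →
    InChargeCone κ effDiv effCurve (p + p')
  cone_effective : ∀ p, InChargeCone κ effDiv effCurve p → p ∈ effDiv
  signature_pos : ∀ p, InChargeCone κ effDiv effCurve p →
    sigPos (kappaMat κ p).toQuadraticForm' = 1
  signature_neg : ∀ p, InChargeCone κ effDiv effCurve p →
    sigNeg (kappaMat κ p).toQuadraticForm' + 1 = b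

/-- A reduced charge vector `(p^a, q_a)`: `p` is a D4-brane charge in the cone and
`q ∈ Λ* + p/2`, i.e. `q_a - κ_{abc} p^b p^c / 2` is an integer. -/
structure Charge {b : ℕ} (X : IntersectionData b) where
  p : Fin b → ℤ
  q : Fin b → ℝ
  p_mem : InChargeCone X.κ X.effDiv X.effCurve p
  q_mem : ∀ i, ∃ z : ℤ, q i = z + (1 / 2) * ∑ j, kappaMat X.κ p i j * (p j : ℝ)

section Vectors

variable {b n : ℕ} {X : IntersectionData b} (γ : Fin n → Charge X)

/-- The Dirac product `γ_{ij} = p_j^a q_{i,a} - p_i^a q_{j,a}`. -/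
def dirac (i j : Fin n) : ℝ :=
  ∑ a, (((γ j).p a : ℝ) * (γ i).q a - ((γ i).p a : ℝ) * (γ j).q a)

/-- The `n b`-dimensional vectors `v_{ij}`, `v_{ij,k}^a = δ_{ki} p_j^a - δ_{kj} p_i^a`. -/
def vec (i j : Fin n) : Fin n → Fin b → ℝ := fun k a =>
  (if k = i then ((γ j).p a : ℝ) else 0) - (if k = j then ((γ i).p a : ℝ) else 0)

/-- The bilinear form `x · y = ∑_i κ_{abc} p_i^a x_i^b y_i^c`. -/
def biform (x y : Fin n → Fin b → ℝ) : ℝ :=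
  ∑ i, ∑ a, ∑ c, kappaMat X.κ (γ i).p a c * x i a * y i c

/-- The point with components `x_i^a = √(2τ₂) κ_i^{ab} q_{i,b}`. -/
def point (τ₂ : ℝ) : Fin n → Fin b → ℝ := fun i a =>
  Real.sqrt (2 * τ₂) * ((kappaMat X.κ (γ i).p)⁻¹ *ᵥ (γ i).q) a

/-- The operator `𝒟(v) = v · (x + (1/2π) ∂_x)`. -/
def diffOp (v : Fin n → Fin b → ℝ) (f : (Fin n → Fin b → ℝ) → ℝ) :
    (Fin n → Fin b → ℝ) → ℝ := fun x =>
  biform γ v x * f x + (1 / (2 * Real.pi)) * fderiv ℝ f x v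

/-- The composition of the operators `op e`, taken in some order. The operators to which this
is applied commute with each other on smooth functions. -/
def opProd {E F : Type} [Fintype E] (op : E → F → F) (f : F) : F :=
  ((Finset.univ : Finset E).toList.map op).foldr (fun D g => D g) f

end Vectors

/-! ### Generalized error functions -/

/-- `E_n(M; u) = ∫ du' exp(-π ∑ (u_i - u'_i)²) ∏ sgn((Mᵗ u')_i)`, with `n = |E|`. -/
def genErr {E : Type} [Fintype E] (M : Matrix E E ℝ) (u : E → ℝ) : ℝ :=
  ∫ u' : E → ℝ, Real.exp (-Real.pi * ∑ i, (u i - u' i) ^ 2) * ∏ i, Real.sign ((Mᵀ *ᵥ u') i)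

/-- `f` is an orthonormal basis, with respect to `B`, of the span of the vectors `v`. -/
def IsOrthonormalFrame {E W : Type} [AddCommGroup W] [Module ℝ W] (B : W → W → ℝ)
    (v f : E → W) : Prop :=
  (∀ i j, B (f i) (f j) = if i = j then 1 else 0) ∧
    Submodule.span ℝ (Set.range f) = Submodule.span ℝ (Set.range v)

/-- The boosted function `Φ^E_n(V; x) = E_n(ℬ·V; ℬ·x)`, where `ℬ` is an orthonormal basis of the
span of the `n = |E|` vectors in `V`. Such a basis exists exactly when the vectors are independent
and span a positive definite subspace; the value does not depend on which one is chosen. -/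
def boostedErr {E W : Type} [Fintype E] [AddCommGroup W] [Module ℝ W] (B : W → W → ℝ)
    (v : E → W) (x : W) : ℝ :=
  if h : ∃ f : E → W, IsOrthonormalFrame B v f then
    genErr (Matrix.of fun k i => B (h.choose k) (v i)) (fun k => B (h.choose k) x)
  else 0

/-! ### Trees -/

/-- An oriented graph with vertices `V` and edges `E`. -/
structure OGraph (V E : Type) where
  src : E → V
  tgt : E → V

namespace OGraph

variable {V E : Type} (T : OGraph V E)

/-- `u` and `v` are joined by an undirected path with edges in `A`. -/
def Linked (A : Set E) : V → V → Prop :=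
  Relation.EqvGen fun u v => ∃ e ∈ A, T.src e = u ∧ T.tgt e = v

/-- `T` is an (unrooted) tree: it is non-empty and connected, and removing any edge
disconnects its ends. -/
def IsTree : Prop :=
  Nonempty V ∧ (∀ u v, T.Linked Set.univ u v) ∧ ∀ e, ¬ T.Linked {e}ᶜ (T.src e) (T.tgt e)

/-- The vertices of the component of the source of `e` after `e` is removed. -/
def srcSide (e : E) : Set V := {v | T.Linked {e}ᶜ (T.src e) v}

/-- The vertices of the component of the target of `e` after `e` is removed. -/
def tgtSide (e : E) : Set V := {v | T.Linked {e}ᶜ (T.tgt e) v}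

/-- The equivalence relation on vertices given by contracting all edges outside `J`. -/
def contractSetoid (J : Finset E) : Setoid V where
  r := T.Linked {e | e ∉ J}
  iseqv := Relation.EqvGen.is_equivalence _

/-- The tree `T_J` obtained by contracting the edges not in `J`. -/
def contract (J : Finset E) : OGraph (Quotient (T.contractSetoid J)) J where
  src e := Quotient.mk _ (T.src e)
  tgt e := Quotient.mk _ (T.tgt e)

/-- The components of the subgraph induced on `S`. -/
def comps (S : Finset V) : Finset (Finset V) :=
  S.image fun u => S.filter fun w => T.Linked {e | T.src e ∈ S ∧ T.tgt e ∈ S} u w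

/-- The number of incoming edges at `v` in the subgraph induced on `S ∋ v`. -/
def inDeg [Fintype E] (S : Finset V) (v : V) : ℕ :=
  (Finset.univ.filter fun e => T.tgt e = v ∧ T.src e ∈ S).card

theorem card_lt_of_mem_comps {S C : Finset V} {v : V} (hv : v ∈ S)
    (hC : C ∈ T.comps (S.erase v)) : C.card < S.card := by
  obtain ⟨u, -, rfl⟩ := Finset.mem_image.1 hC
  exact lt_of_le_of_lt (Finset.card_le_card (Finset.filter_subset _ _))
    (Finset.card_erase_lt_of_mem hv)

/-- The coefficient `a` of the subtree induced on `S`: the average over `v ∈ S` of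
`(-1)^{n_v^+}` times the product of the coefficients of the subtrees left after removing `v`. -/
def aSub [Fintype E] (S : Finset V) : ℚ :=
  (1 / (S.card : ℚ)) * ∑ v : {v // v ∈ S}, (-1 : ℚ) ^ T.inDeg S v.1 *
    ∏ C : {C // C ∈ T.comps (S.erase v.1)}, aSub C.1
termination_by S.card
decreasing_by exact T.card_lt_of_mem_comps v.2 C.2

/-- The coefficient `a_T`. -/
def aCoef [Fintype V] [Fintype E] : ℚ := T.aSub Finset.univ

section Labelled

/-! The vertices of `T` carry the charges `γ_i`; `c i` is the vertex carrying the `i`-th one, and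
the charge of a vertex is the sum of the charges which it carries. -/

variable {b n : ℕ} {X : IntersectionData b} (γ : Fin n → Charge X) (c : Fin n → V)

/-- `v_e = ∑_{i ∈ T_e^s} ∑_{j ∈ T_e^t} v_{ij}`. -/
def edgeVec (e : E) : Fin n → Fin b → ℝ :=
  ∑ i with c i ∈ T.srcSide e, ∑ j with c j ∈ T.tgtSide e, vec γ i j

/-- `Γ_e = ∑_{i ∈ T_e^s} ∑_{j ∈ T_e^t} γ_{ij}`. -/
def edgeDirac (e : E) : ℝ :=
  ∑ i with c i ∈ T.srcSide e, ∑ j with c j ∈ T.tgtSide e, dirac γ i j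

/-- `v_{s(e)t(e)}` for the charges of the two ends of `e`. -/
def endVec (e : E) : Fin n → Fin b → ℝ :=
  ∑ i with c i = T.src e, ∑ j with c j = T.tgt e, vec γ i j

/-- `γ_{s(e)t(e)}`, the Dirac product of the charges of the two ends of `e`. -/
def endDirac (e : E) : ℝ :=
  ∑ i with c i = T.src e, ∑ j with c j = T.tgt e, dirac γ i j

/-- `Φ^E_T(x) = Φ^E_{|E_T|}({v_e}; x)`. -/
def treeErr [Fintype E] (x : Fin n → Fin b → ℝ) : ℝ :=
  boostedErr (biform γ) (T.edgeVec γ c) x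

/-- `κ_T = ∏_e γ_{s(e)t(e)}`. -/
def kappa [Fintype E] : ℝ := ∏ e, T.endDirac γ c e

/-- `𝖾_{T_J} = Φ^E_{T_J}(0)`, for the tree `T_J` obtained by contracting the edges not in `J`;
its vertices carry the charges of all the vertices of `T` which are identified. -/
def eContract (J : Finset E) : ℝ :=
  (T.contract J).treeErr γ (fun i => Quotient.mk (T.contractSetoid J) (c i)) 0

/-- `𝖲_T = ∑_{J ⊆ E_T} 𝖾_{T_J} ∏_{e ∈ J} δ_{Γ_e} ∏_{e ∉ J} sgn(Γ_e)`. -/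
def signSum [Fintype E] : ℝ :=
  ∑ J : Finset E, T.eContract γ c J * (∏ e ∈ J, if T.edgeDirac γ c e = 0 then (1 : ℝ) else 0) *
    ∏ e ∈ Jᶜ, Real.sign (T.edgeDirac γ c e)

/-- `∏_e sgn(Γ_e)`. -/
def signProd [Fintype E] : ℝ := ∏ e, Real.sign (T.edgeDirac γ c e)

end Labelled

end OGraph

/-- Three trees with chosen vertices `u r` are joined by two additional edges, from `u i` to `u j`
and from `u k` to `u l`. -/
def glue {V E : Fin 3 → Type} (T : ∀ r, OGraph (V r) (E r)) (u : ∀ r, V r) (i j k l : Fin 3) :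
    OGraph (Σ r, V r) ((Σ r, E r) ⊕ Bool) where
  src := Sum.elim (fun e => ⟨e.1, (T e.1).src e.2⟩) fun s => if s then ⟨k, u k⟩ else ⟨i, u i⟩
  tgt := Sum.elim (fun e => ⟨e.1, (T e.1).tgt e.2⟩) fun s => if s then ⟨l, u l⟩ else ⟨j, u j⟩

/-- The trees `T̂₁`, `T̂₂`, `T̂₃` (numbered from `0`) built from three trees with chosen vertices
`u₁`, `u₂`, `u₃` and the oriented edges `e₁ : u₁ → u₂`, `e₂ : u₁ → u₃`, `e₃ : u₂ → u₃`: the tree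
`T̂₁` uses `e₁, e₂`, the tree `T̂₂` uses `e₂, e₃` and the tree `T̂₃` uses `e₁, e₃`. -/
def hatTree {V E : Fin 3 → Type} (T : ∀ r, OGraph (V r) (E r)) (u : ∀ r, V r) :
    Fin 3 → OGraph (Σ r, V r) ((Σ r, E r) ⊕ Bool) :=
  ![glue T u 0 1 0 2, glue T u 0 2 1 2, glue T u 0 1 1 2]

/-- The edges of a glued tree other than the two additional ones. -/
def oldEdges {E : Fin 3 → Type} [∀ r, Fintype (E r)] : Finset ((Σ r, E r) ⊕ Bool) :=
  Finset.univ.filter fun e => e.isLeft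

/-! ### Labelled trees and marked trees -/

/-- A choice of orientation of every edge that a graph on `V` can have. -/
structure EdgeOrientation (V : Type) where
  src : Sym2 V → V
  tgt : Sym2 V → V
  spec : ∀ e, s(src e, tgt e) = e

/-- Trees with vertex set `V`. -/
abbrev TreeOn (V : Type) : Type := {G : SimpleGraph V // G.IsTree}

/-- The oriented tree given by a tree on `V` and a choice of orientations. -/
def TreeOn.toOGraph {V : Type} (o : EdgeOrientation V) (G : TreeOn V) : OGraph V G.1.edgeSet where
  src e := o.src e.1
  tgt e := o.tgt e.1

/-- The ways of distributing `n` labels over the vertices of a marked tree with `n - 2m` vertices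
and `m` marks: partitions of the labels into `n - 2m` blocks of odd size, where the block of size
`1 + 2 m_v` belongs to a vertex `v` with `m_v` marks (so that `∑ m_v = m`). -/
def markedPartitions (n m : ℕ) : Finset (Finpartition (Finset.univ : Finset (Fin n))) :=
  Finset.univ.filter fun P => P.parts.card + 2 * m = n ∧ ∀ B ∈ P.parts, Odd B.card

/-- The vertices of the marked trees with label distribution `P` are the blocks of `P`. -/
abbrev Blocks {n : ℕ} (P : Finpartition (Finset.univ : Finset (Fin n))) : Type :=
  {B // B ∈ P.parts}

/-- The block containing a label. -/
def blockOf {n : ℕ} (P : Finpartition (Finset.univ : Finset (Fin n))) (i : Fin n) : Blocks P :=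
  ⟨P.part i, P.part_mem.2 (Finset.mem_univ i)⟩

/-! ### The functions `ℰ_n` and their limits -/

section Main

variable {b n : ℕ} {X : IntersectionData b} (o : ∀ V : Type, EdgeOrientation V)
  (γ : Fin n → Charge X)

/-- The operator `𝒟_m({p_s})` of a vertex carrying the `2m + 1` charges in `B`: the sum over trees
with these labels of `a_T ∏_e 𝒟(v_{s(e)t(e)})`. -/
def markOp (B : Finset (Fin n)) (f : (Fin n → Fin b → ℝ) → ℝ) : (Fin n → Fin b → ℝ) → ℝ :=
  fun x => ∑ G : TreeOn {i // i ∈ B}, ((G.toOGraph (o _)).aCoef : ℝ) *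
    opProd (fun e => diffOp γ (vec γ ((G.toOGraph (o _)).src e).1 ((G.toOGraph (o _)).tgt e).1)) f x

/-- `𝒱_m({γ_s}) = ∑_T a_T κ_T({γ_s})` for the `2m + 1` charges in `B`. -/
def markFactor (B : Finset (Fin n)) : ℝ :=
  ∑ G : TreeOn {i // i ∈ B}, ((G.toOGraph (o _)).aCoef : ℝ) *
    ∏ e, dirac γ ((G.toOGraph (o _)).src e).1 ((G.toOGraph (o _)).tgt e).1

/-- `Φ^ℰ_n(x)`, the sum over marked trees of
`[∏_v 𝒟_{m_v} ∏_e 𝒟(v_{s(e)t(e)})] Φ^E_T(x)`, divided by `n!`. -/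
def vertexKernel (x : Fin n → Fin b → ℝ) : ℝ :=
  (1 / (n.factorial : ℝ)) * ∑ m ∈ Finset.range ((n - 1) / 2 + 1),
    ∑ P ∈ markedPartitions n m, ∑ G : TreeOn (Blocks P),
      opProd (fun B : Blocks P => markOp o γ B.1)
        (opProd (fun e => diffOp γ ((G.toOGraph (o _)).endVec γ (blockOf P) e))
          ((G.toOGraph (o _)).treeErr γ (blockOf P))) x

/-- `ℰ_n({γ_i}; τ₂) = Φ^ℰ_n(x) / (√(2τ₂))^{n-1}`. -/
def vertexFn (τ₂ : ℝ) : ℝ :=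
  vertexKernel o γ (point γ τ₂) / Real.sqrt (2 * τ₂) ^ (n - 1)

/-- The sum over marked trees of `[∏_v 𝒱_{m_v}] κ_T 𝖲_T`, divided by `n!`. -/
def vertexLimit : ℝ :=
  (1 / (n.factorial : ℝ)) * ∑ m ∈ Finset.range ((n - 1) / 2 + 1),
    ∑ P ∈ markedPartitions n m, ∑ G : TreeOn (Blocks P),
      (∏ B : Blocks P, markFactor o γ B.1) * (G.toOGraph (o _)).kappa γ (blockOf P) *
        (G.toOGraph (o _)).signSum γ (blockOf P)

/-- The same expression with the product of signs `∏_e sgn(Γ_e)` in place of `𝖲_T`. -/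
def naiveVertexLimit : ℝ :=
  (1 / (n.factorial : ℝ)) * ∑ m ∈ Finset.range ((n - 1) / 2 + 1),
    ∑ P ∈ markedPartitions n m, ∑ G : TreeOn (Blocks P),
      (∏ B : Blocks P, markFactor o γ B.1) * (G.toOGraph (o _)).kappa γ (blockOf P) *
        (G.toOGraph (o _)).signProd γ (blockOf P)

end Main

end

end D4Completion

open MeasureTheory Filter Topology
open scoped Matrix ContDiff SchwartzMap

namespace D4Completion

noncomputable section

open scoped Classical

/-! ### The Gaussian measure -/

/-! A boosted error function is a Gaussian average: `Φ^E(x)` is the mean of `∏ sgn(v_e · (x + y))`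
for `y` Gaussian in any positive definite space with an orthonormal basis whose span contains the
`v_e` (`boostedErr_eq_integral`). Everything is read off from this average.

Limit. Put `x = t ξ` with `ξ_i = κ_i⁻¹ q_i` and `t = √(2τ₂)`, so that `v_e · ξ = Γ_e`. As `t → ∞`
each factor with `Γ_e ≠ 0` freezes to `sgn Γ_e`, while those with `Γ_e = 0` keep fluctuating. The
mean of the latter is `Φ^E_{T_J}(0)`, with `J` the set of edges where `Γ_e` vanishes, because
contracting the other edges leaves these `v_e` unchanged. Hence the limit is `𝖲_T`. Moreover `Φ^E`
is a bounded function convolved with a Gaussian, so all its derivatives are bounded. In `𝒟(v)` the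
derivative is then of lower order than multiplication by `v · x`, and `𝒟(v)` multiplies the leading
coefficient by `v · ξ`, a Dirac product (`HasLeading.linear_add_deriv`). Every marked tree
contributes `n - 1` such operators, which matches the normalisation.

Positivity. The average requires the `v_e` of a tree to be independent with positive definite span.
Each `v_e` is `chi φ` for `φ` the indicator of the source side of `e`. The Hodge index inequality
for the total charge bounds the square of `chi φ` below by a positive multiple of `∑ m_i m_j (φ_i -
φ_j)²` with `m_i = (p_i P²) > 0` (`formB_chi_pos`).

Identity. In the three glued trees the added edges have, up to sign, vectors among `w_0, w_1, w_2`
with `w_0 + w_1 + w_2 = 0`, and the old edges have the same vectors. Under one common Gaussian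
integral the claim becomes `s₀s₁ + s₁s₂ + s₀s₂ = -1` for the signs of three numbers with zero sum,
not all zero.

Counterexample. For three charges with `γ₁₂ = γ₂₃ = γ₃₁ = 1` all `Γ_e` vanish, so products of signs
give zero on trees with three vertices. By the same sign identity the true sum over the three stars
is `1`. The one-vertex marked tree contributes equally to both formulas. -/

/-- The probability measure on `ℝ^K` with density `exp (-π ∑ u_i²)`. -/
def gaussMeasure (K : Type) [Fintype K] : Measure (K → ℝ) :=
  volume.withDensity fun u => ENNReal.ofReal (Real.exp (-Real.pi * ∑ i, u i ^ 2))

section Gauss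

variable {K J : Type} [Fintype K] [Fintype J]

lemma integral_gaussMeasure {G : Type*} [NormedAddCommGroup G] [NormedSpace ℝ G]
    (F : (K → ℝ) → G) :
    ∫ u, F u ∂gaussMeasure K = ∫ u, Real.exp (-Real.pi * ∑ i, u i ^ 2) • F u := by
  rw [gaussMeasure, integral_withDensity_eq_integral_toReal_smul (by fun_prop) (by simp)]
  simp [Real.exp_nonneg]

lemma integrable_gaussian : Integrable fun u : K → ℝ => Real.exp (-Real.pi * ∑ i, u i ^ 2) := by
  have h := (GaussianFourier.integrable_cexp_neg_mul_sum_add (b := (Real.pi : ℂ)) (ι := K)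
    (by simpa using Real.pi_pos) 0).norm
  refine h.congr (Eventually.of_forall fun u => ?_)
  beta_reduce
  rw [Complex.norm_exp]
  have : (-(Real.pi : ℂ) * ∑ i, (u i : ℂ) ^ 2 + ∑ i, (0 : K → ℂ) i * (u i : ℂ)) =
      ((-Real.pi * ∑ i, u i ^ 2 : ℝ) : ℂ) := by
    push_cast
    simp
  rw [this, Complex.ofReal_re]

/-- With the exponent `-π |u|²` the Gaussian integral has prefactor `1`. The value depends on `L`
only through its Euclidean norm, which yields both the normalisation (at `L = 0`) and the invariance
under isometries. -/
lemma charFunDual_gaussMeasure (L : StrongDual ℝ (K → ℝ)) :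
    charFunDual (gaussMeasure K) L =
      Complex.exp ((-(∑ i, L (Pi.single i 1) ^ 2) / (4 * Real.pi) : ℝ)) := by
  rw [charFunDual_apply, integral_gaussMeasure]
  have h := GaussianFourier.integral_cexp_neg_mul_sum_add (b := (Real.pi : ℂ)) (ι := K)
    (by simpa using Real.pi_pos) (fun i => (L (Pi.single i 1) : ℂ) * Complex.I)
  rw [div_self (by exact_mod_cast Real.pi_ne_zero), Complex.one_cpow, one_mul] at h
  convert h using 1
  · congr 1
    ext u
    rw [Complex.exp_add, Complex.real_smul]
    congr 1
    · push_cast; rfl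
    · congr 1
      have : L u = ∑ i, u i * L (Pi.single i 1) := by
        conv_lhs => rw [← Finset.univ_sum_single u, map_sum]
        refine Finset.sum_congr rfl fun i _ => ?_
        rw [← smul_eq_mul, ← map_smul, ← Pi.single_smul, smul_eq_mul, mul_one]
      rw [this]
      push_cast
      rw [Finset.sum_mul]
      exact Finset.sum_congr rfl fun i _ => by ring
  · push_cast
    simp [mul_pow, Finset.sum_neg_distrib]

instance : IsProbabilityMeasure (gaussMeasure K) := by
  have hfin : IsFiniteMeasure (gaussMeasure K) :=
    isFiniteMeasure_withDensity_ofReal (integrable_gaussian (K := K)).2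
  have h := charFunDual_gaussMeasure (K := K) 0
  rw [charFunDual_apply] at h
  simp only [zero_apply, Complex.ofReal_zero, zero_mul, Complex.exp_zero] at h
  refine ⟨?_⟩
  rw [integral_const] at h
  have h' : (gaussMeasure K).real Set.univ = 1 := by
    have := congrArg Complex.re h
    simpa using this
  rw [measureReal_def] at h'
  rwa [← ENNReal.toReal_eq_one_iff]

lemma gaussMeasure_ac : gaussMeasure K ≪ volume := withDensity_absolutelyContinuous _ _

/-- A linear functional which is not zero vanishes only on a null set. -/
lemma gaussMeasure_ae_ne (l : (K → ℝ) →ₗ[ℝ] ℝ) (hl : l ≠ 0) :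
    ∀ᵐ u ∂gaussMeasure K, l u ≠ 0 := by
  have := Measure.addHaar_submodule (volume : Measure (K → ℝ)) (LinearMap.ker l)
    (by rwa [Ne, LinearMap.ker_eq_top])
  have h : ∀ᵐ u : K → ℝ, l u ≠ 0 := by
    rw [ae_iff]
    convert this using 2
    ext u
    simp
  exact gaussMeasure_ac.ae_le h

/-- The image of the Gaussian measure under the adjoint of an isometric embedding is the Gaussian
measure. -/
lemma map_gaussMeasure (O : Matrix J K ℝ) (hO : O * Oᵀ = 1) :
    (gaussMeasure K).map (fun u => O *ᵥ u) = gaussMeasure J := by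
  have hcl : (fun u : K → ℝ => O *ᵥ u) =
      (LinearMap.toContinuousLinearMap (Matrix.mulVecLin O)) := by
    ext; simp
  have : IsProbabilityMeasure ((gaussMeasure K).map (fun u => O *ᵥ u)) := by
    rw [hcl]
    exact Measure.isProbabilityMeasure_map (by fun_prop)
  refine Measure.ext_of_charFunDual ?_
  ext L
  rw [hcl, charFunDual_map, charFunDual_gaussMeasure, charFunDual_gaussMeasure]
  congr 4
  have h1 : ∀ k, (L.comp (LinearMap.toContinuousLinearMap (Matrix.mulVecLin O))) (Pi.single k 1)
      = ∑ j, O j k * L (Pi.single j 1) := by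
    intro k
    simp only [ContinuousLinearMap.comp_apply, LinearMap.coe_toContinuousLinearMap',
      Matrix.mulVecLin_apply, Matrix.mulVec_single_one]
    conv_lhs => rw [← Finset.univ_sum_single (O.col k), map_sum]
    refine Finset.sum_congr rfl fun j _ => ?_
    rw [← smul_eq_mul, ← map_smul, ← Pi.single_smul, smul_eq_mul, mul_one]
    rfl
  set l : J → ℝ := fun j => L (Pi.single j 1) with hl
  -- It remains to compare the norms of `Oᵀ l` and `l`, which agree since `O Oᵀ = 1`.
  have h2 : ∑ k, (∑ j, O j k * l j) ^ 2 = (Oᵀ *ᵥ l) ⬝ᵥ (Oᵀ *ᵥ l) := by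
    simp [dotProduct, Matrix.mulVec, sq]
  have h3 : ∑ j, l j ^ 2 = l ⬝ᵥ l := by simp [dotProduct, sq]
  simp only [h1]
  change ∑ k, (∑ j, O j k * l j) ^ 2 = ∑ j, l j ^ 2
  rw [h2, h3, Matrix.dotProduct_mulVec, Matrix.vecMul_transpose, Matrix.mulVec_mulVec, hO,
    Matrix.one_mulVec]

end Gauss

/-! ### Smoothing of bounded functions -/

section Convolution

variable {E F : Type} [NormedAddCommGroup E] [NormedSpace ℝ E] [FiniteDimensional ℝ E]
  [MeasurableSpace E] [BorelSpace E] (μ : Measure E) [μ.IsAddHaarMeasure]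
  [NormedAddCommGroup F] [NormedSpace ℝ F]

/-- The convolution of a Schwartz function with a function `s`. -/
def smoothing (s : E → ℝ) (φ : 𝓢(E, F)) (u : E) : F := ∫ w, s w • φ (u - w) ∂μ

-- The exponent is one more than the dimension, so that the bound is integrable.
omit [FiniteDimensional ℝ E] [MeasurableSpace E] [BorelSpace E] in
lemma schwartz_bound (φ : 𝓢(E, F)) :
    ∃ C, 0 ≤ C ∧ ∀ x, ‖φ x‖ ≤ C * (1 + ‖x‖) ^ (-((Module.finrank ℝ E + 1 : ℕ) : ℝ)) := by
  set r := Module.finrank ℝ E + 1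
  refine ⟨2 ^ r * ((Finset.Iic (r, 0)).sup fun m => SchwartzMap.seminorm ℝ m.1 m.2) φ,
    by positivity, fun x => ?_⟩
  have h := SchwartzMap.one_add_le_sup_seminorm_apply (𝕜 := ℝ) (m := (r, 0)) le_rfl le_rfl φ x
  simp only [norm_iteratedFDeriv_zero] at h
  have hp : 0 < 1 + ‖x‖ := by positivity
  rw [Real.rpow_neg hp.le, Real.rpow_natCast, ← div_eq_mul_inv, le_div_iff₀ (by positivity)]
  linarith

variable {μ}

/-- One integrable majorant serves all `u` near `u₀`, as differentiation under the integral sign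
requires. It exists because `1 + ‖u₀ - w‖ ≤ 2 (1 + ‖u - w‖)` on the unit ball. -/
lemma schwartz_sub_bound (φ : 𝓢(E, F)) (u₀ : E) : ∃ g : E → ℝ, Integrable g μ ∧
    ∀ w, ∀ u ∈ Metric.ball u₀ 1, ‖φ (u - w)‖ ≤ g w := by
  obtain ⟨C, hC, h⟩ := schwartz_bound φ
  set r : ℝ := ((Module.finrank ℝ E + 1 : ℕ) : ℝ)
  refine ⟨fun w => C * (2 ^ r * (1 + ‖u₀ - w‖) ^ (-r)), ?_, fun w u hu => (h _).trans ?_⟩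
  · refine Integrable.const_mul (Integrable.const_mul ?_ _) _
    exact (integrable_one_add_norm (μ := μ) (r := r) (by simp [r])).comp_sub_left u₀
  · refine mul_le_mul_of_nonneg_left ?_ hC
    have h1 : ‖u₀ - w‖ ≤ ‖u - w‖ + 1 := by
      have := norm_sub_le_norm_sub_add_norm_sub u₀ u w
      rw [mem_ball_iff_norm'] at hu
      linarith
    have h2 : (1 + ‖u₀ - w‖) / 2 ≤ 1 + ‖u - w‖ := by linarith [norm_nonneg (u - w)]
    have h3 : 0 < 1 + ‖u₀ - w‖ := by positivity
    have hr : -r ≤ 0 := neg_nonpos.2 (Nat.cast_nonneg _)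
    calc (1 + ‖u - w‖) ^ (-r) ≤ ((1 + ‖u₀ - w‖) / 2) ^ (-r) :=
          Real.rpow_le_rpow_of_nonpos (by positivity) h2 hr
      _ = 2 ^ r * (1 + ‖u₀ - w‖) ^ (-r) := by
          rw [Real.div_rpow h3.le (by norm_num), Real.rpow_neg (by norm_num : (0:ℝ) ≤ 2),
            div_inv_eq_mul,
            mul_comm]

variable {s : E → ℝ} (hs : Measurable s) (hs1 : ∀ x, |s x| ≤ 1)

include hs hs1

lemma smoothing_integrable (φ : 𝓢(E, F)) (u : E) :
    Integrable (fun w => s w • φ (u - w)) μ := by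
  obtain ⟨g, hg, hle⟩ := schwartz_sub_bound (μ := μ) φ u
  refine hg.mono' ?_ (Eventually.of_forall fun w => ?_)
  · exact hs.aestronglyMeasurable.smul (φ.continuous.comp (by fun_prop)).aestronglyMeasurable
  · rw [norm_smul]
    calc ‖s w‖ * ‖φ (u - w)‖ ≤ 1 * ‖φ (u - w)‖ := by gcongr; exact hs1 w
      _ ≤ g w := by rw [one_mul]; exact hle w u (Metric.mem_ball_self one_pos)

omit hs in
lemma smoothing_bounded (φ : 𝓢(E, F)) : ∃ C, ∀ u, ‖smoothing μ s φ u‖ ≤ C := by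
  refine ⟨∫ w, ‖φ w‖ ∂μ, fun u => ?_⟩
  calc ‖smoothing μ s φ u‖ ≤ ∫ w, ‖φ (u - w)‖ ∂μ := by
        refine norm_integral_le_of_norm_le (φ.integrable.norm.comp_sub_left u)
          (Eventually.of_forall fun w => ?_)
        rw [norm_smul]
        exact mul_le_of_le_one_left (norm_nonneg _) (hs1 w)
    _ = ∫ w, ‖φ w‖ ∂μ := integral_sub_left_eq_self (fun w => ‖φ w‖) μ u

/-- The derivative falls on the Schwartz factor, so it is again a smoothing of the same `s`, only
with another target space. The inductions on the order of differentiation below therefore quantify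
over all targets. -/
lemma smoothing_hasFDerivAt (φ : 𝓢(E, F)) (u : E) :
    HasFDerivAt (smoothing μ s φ) (smoothing μ s (SchwartzMap.fderivCLM ℝ E F φ) u) u := by
  obtain ⟨g, hg, hle⟩ := schwartz_sub_bound (μ := μ) (SchwartzMap.fderivCLM ℝ E F φ) u
  refine hasFDerivAt_integral_of_dominated_of_fderiv_le (𝕜 := ℝ) (bound := g)
    (F' := fun v w => s w • SchwartzMap.fderivCLM ℝ E F φ (v - w))
    (Metric.ball_mem_nhds u one_pos)
    (Eventually.of_forall fun v => (smoothing_integrable hs hs1 φ v).1)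
    (smoothing_integrable hs hs1 φ u) (smoothing_integrable hs hs1 _ u).1
    (Eventually.of_forall fun w v hv => ?_) hg (Eventually.of_forall fun w v hv => ?_)
  · rw [norm_smul]
    exact (mul_le_of_le_one_left (norm_nonneg _) (hs1 w)).trans (hle w v hv)
  · rw [SchwartzMap.fderivCLM_apply]
    have h1 : HasFDerivAt φ (fderiv ℝ φ (v - w)) (v - w) := φ.differentiableAt.hasFDerivAt
    exact (((hasFDerivAt_comp_sub w).2 h1).const_smul (s w))

lemma smoothing_contDiff (k : ℕ) : ∀ {F : Type} [NormedAddCommGroup F] [NormedSpace ℝ F]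
    (φ : 𝓢(E, F)), ContDiff ℝ k (smoothing μ s φ) := by
  induction k with
  | zero =>
    intro F _ _ φ
    refine contDiff_zero.2 (continuous_iff_continuousAt.2 fun u => ?_)
    exact (smoothing_hasFDerivAt hs hs1 φ u).continuousAt
  | succ k ih =>
    intro F _ _ φ
    have hd := fun u => smoothing_hasFDerivAt (μ := μ) hs hs1 φ u
    rw [Nat.cast_succ, contDiff_succ_iff_fderiv]
    refine ⟨fun u => (hd u).differentiableAt, by simp, ?_⟩
    rw [show fderiv ℝ (smoothing μ s φ) = _ from funext fun u => (hd u).fderiv]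
    exact ih _

lemma smoothing_iteratedFDeriv_bounded (k : ℕ) : ∀ {F : Type} [NormedAddCommGroup F]
    [NormedSpace ℝ F] (φ : 𝓢(E, F)), ∃ C, ∀ u, ‖iteratedFDeriv ℝ k (smoothing μ s φ) u‖ ≤ C := by
  induction k with
  | zero =>
    intro F _ _ φ
    simpa using smoothing_bounded hs1 φ
  | succ k ih =>
    intro F _ _ φ
    have hd := fun u => smoothing_hasFDerivAt (μ := μ) hs hs1 φ u
    simp only [← norm_iteratedFDeriv_fderiv]
    rw [show fderiv ℝ (smoothing μ s φ) = _ from funext fun u => (hd u).fderiv]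
    exact ih _

end Convolution

/-- The Gaussian `exp (-π ∑ u_i²)` is a Schwartz function. -/
def gaussSchwartz (K : Type) [Fintype K] : 𝓢(K → ℝ, ℝ) where
  toFun u := Real.exp (-Real.pi * ∑ i, u i ^ 2)
  smooth' := by fun_prop
  decay' k n := by
    set q : (K → ℝ) → ℝ := fun u => -Real.pi * ∑ i, u i ^ 2 with hq
    have hqt : q.HasTemperateGrowth := by
      refine (Function.HasTemperateGrowth.const _).mul (.sum fun i _ => ?_)
      exact (ContinuousLinearMap.proj (R := ℝ) (φ := fun _ : K => ℝ) i).hasTemperateGrowth.pow 2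
    obtain ⟨m, C, hC, h⟩ := hqt.norm_iteratedFDeriv_le_uniform n
    have hqle : ∀ u, ‖u‖ ^ 2 ≤ -q u := by
      intro u
      have h0 : 0 ≤ ∑ i, u i ^ 2 := Finset.sum_nonneg fun i _ => sq_nonneg _
      have h1 : ‖u‖ ≤ √(∑ i, u i ^ 2) := by
        refine (pi_norm_le_iff_of_nonneg (Real.sqrt_nonneg _)).2 fun i => Real.abs_le_sqrt ?_
        exact Finset.single_le_sum (f := fun i => u i ^ 2) (fun _ _ => sq_nonneg _)
          (Finset.mem_univ i)
      have h2 : ‖u‖ ^ 2 ≤ ∑ i, u i ^ 2 := by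
        rw [← Real.sq_sqrt h0]
        gcongr
      have h3 := Real.pi_gt_three
      simp only [hq]
      nlinarith
    have hexp : ∃ A, ∀ r : ℝ, 0 ≤ r → (1 + r) ^ (k + m * n) * Real.exp (-r ^ 2) ≤ A := by
      refine ⟨Real.exp (((k + m * n : ℕ) : ℝ) ^ 2 / 4), fun r hr => ?_⟩
      calc (1 + r) ^ (k + m * n) * Real.exp (-r ^ 2)
          ≤ Real.exp r ^ (k + m * n) * Real.exp (-r ^ 2) := by
            gcongr
            linarith [Real.add_one_le_exp r]
        _ = Real.exp ((k + m * n : ℕ) * r - r ^ 2) := by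
            rw [← Real.exp_nat_mul, ← Real.exp_add, sub_eq_add_neg]
        _ ≤ _ := by
            rw [Real.exp_le_exp]
            nlinarith [sq_nonneg (r - ((k + m * n : ℕ) : ℝ) / 2)]
    obtain ⟨A, hA⟩ := hexp
    -- The bound for derivatives of `exp ∘ q` needs the `i`-th derivative of `q` to be at most `D ^
    -- i`. Taking `C + 1` in place of `C` makes `D ≥ 1`, hence `D ≤ D ^ i` for `i ≥ 1`.
    refine ⟨n.factorial * (C + 1) ^ n * A, fun u => ?_⟩
    have h1 := norm_iteratedFDeriv_comp_le (𝕜 := ℝ) (g := Real.exp) (f := q) (n := n) (N := n)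
      Real.contDiff_exp (hqt.1.of_le (by exact_mod_cast le_top)) le_rfl u (C := Real.exp (q u))
      (D := (C + 1) * (1 + ‖u‖) ^ m)
      (fun i _ => by
        rw [norm_iteratedFDeriv_eq_norm_iteratedDeriv, iteratedDeriv_eq_iterate,
          Real.iter_deriv_exp,
          Real.norm_of_nonneg (Real.exp_nonneg _)])
      (fun i hi hin => by
        refine (h i hin u).trans ?_
        have hu : 1 ≤ (1 + ‖u‖) ^ m := one_le_pow₀ (by simp)
        calc C * (1 + ‖u‖) ^ m ≤ (C + 1) * (1 + ‖u‖) ^ m := by gcongr; linarith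
          _ ≤ _ := le_self_pow₀ (by nlinarith) (by omega))
    calc ‖u‖ ^ k * ‖iteratedFDeriv ℝ n (Real.exp ∘ q) u‖
        ≤ (1 + ‖u‖) ^ k * (n.factorial * Real.exp (- ‖u‖ ^ 2) * ((C + 1) * (1 + ‖u‖) ^ m) ^ n) := by
          gcongr
          · linarith
          · refine h1.trans ?_
            gcongr
            linarith [hqle u]
      _ = n.factorial * (C + 1) ^ n * ((1 + ‖u‖) ^ (k + m * n) * Real.exp (-‖u‖ ^ 2)) := by
          rw [mul_pow, pow_add, pow_mul]; ring
      _ ≤ _ := by gcongr; exact hA _ (norm_nonneg u)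

/-! ### Boosted error functions -/

section Frames

variable {E K W : Type} [Fintype E] [Fintype K] [AddCommGroup W] [Module ℝ W]
  {β : LinearMap.BilinForm ℝ W}

open scoped MatrixOrder in
/-- A family whose Gram matrix is positive definite has an orthonormal frame. -/
lemma exists_orthonormalFrame (hβ : ∀ x y, β x y = β y x) (v : E → W)
    (hv : ∀ c : E → ℝ, c ≠ 0 → 0 < β (∑ e, c e • v e) (∑ e, c e • v e)) :
    ∃ f : E → W, IsOrthonormalFrame (fun x y => β x y) v f := by
  set G : Matrix E E ℝ := Matrix.of fun i j => β (v i) (v j) with hG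
  have hGpos : G.PosDef := by
    refine Matrix.PosDef.of_dotProduct_mulVec_pos ?_ fun c hc => ?_
    · ext i j
      change β (v j) (v i) = β (v i) (v j)
      exact hβ _ _
    · have h := hv c hc
      simp only [map_sum, map_smul, LinearMap.sum_apply, LinearMap.smul_apply, smul_eq_mul,
        Finset.mul_sum] at h
      refine h.trans_eq ?_
      simp only [dotProduct, Matrix.mulVec, hG, Matrix.of_apply, Finset.mul_sum, star_trivial]
      rw [Finset.sum_comm]
      exact Finset.sum_congr rfl fun j _ => Finset.sum_congr rfl fun i _ => by ring
  -- Writing the Gram matrix as `Rᵀ R` with `R` invertible, the frame is the family `v` multiplied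
  -- by `R⁻¹`.
  obtain ⟨R, hR⟩ := CStarAlgebra.nonneg_iff_eq_star_mul_self.mp hGpos.posSemidef.nonneg
  rw [Matrix.star_eq_conjTranspose, Matrix.conjTranspose_eq_transpose_of_trivial] at hR
  have hRu : IsUnit R.det := by
    have h := hGpos.isUnit
    rw [hR, Matrix.isUnit_iff_isUnit_det, Matrix.det_mul] at h
    exact isUnit_of_mul_isUnit_right h
  have hfv : ∀ e, v e = ∑ k, R k e • ∑ i, R⁻¹ i k • v i := by
    intro e
    simp only [Finset.smul_sum, smul_smul]
    rw [Finset.sum_comm]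
    have h : ∀ i, ∑ k, R k e * R⁻¹ i k = (1 : Matrix E E ℝ) i e := by
      intro i
      rw [← Matrix.nonsing_inv_mul R hRu, Matrix.mul_apply]
      exact Finset.sum_congr rfl fun k _ => mul_comm _ _
    simp [← Finset.sum_smul, h, Matrix.one_apply]
  refine ⟨fun k => ∑ i, R⁻¹ i k • v i, fun k l => ?_, le_antisymm ?_ ?_⟩
  · have h1 : (R⁻¹)ᵀ * G * R⁻¹ = 1 := by
      rw [hR, Matrix.mul_assoc, Matrix.mul_assoc, Matrix.mul_nonsing_inv _ hRu, Matrix.mul_one,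
        ← Matrix.transpose_mul, Matrix.mul_nonsing_inv _ hRu, Matrix.transpose_one]
    have h2 := congrFun (congrFun h1 k) l
    rw [Matrix.one_apply] at h2
    rw [← h2]
    simp only [map_sum, map_smul, LinearMap.sum_apply, LinearMap.smul_apply, smul_eq_mul,
      Matrix.mul_apply, Matrix.transpose_apply, hG, Matrix.of_apply, Finset.sum_mul, Finset.mul_sum]
    exact Finset.sum_congr rfl fun j _ => Finset.sum_congr rfl fun i _ => by ring
  · rw [Submodule.span_le]
    rintro _ ⟨k, rfl⟩
    exact Submodule.sum_mem _ fun i _ => Submodule.smul_mem _ _ (Submodule.subset_span ⟨i, rfl⟩)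
  · rw [Submodule.span_le]
    rintro _ ⟨e, rfl⟩
    rw [SetLike.mem_coe, hfv e]
    exact Submodule.sum_mem _ fun k _ => Submodule.smul_mem _ _ (Submodule.subset_span ⟨k, rfl⟩)

/-- Subfamilies inherit the existence of orthonormal frames. -/
lemma exists_orthonormalFrame_subtype (hβ : ∀ x y, β x y = β y x) {v : E → W}
    (hv : ∀ c : E → ℝ, c ≠ 0 → 0 < β (∑ e, c e • v e) (∑ e, c e • v e)) (Z : Finset E) :
    ∃ f : Z → W, IsOrthonormalFrame (fun x y => β x y) (fun e : Z => v e) f := by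
  refine exists_orthonormalFrame hβ _ fun c hc => ?_
  have h := hv (fun e => if h : e ∈ Z then c ⟨e, h⟩ else 0) fun h0 => hc ?_
  · have h1 : ∑ e, (if h : e ∈ Z then c ⟨e, h⟩ else 0) • v e = ∑ e : Z, c e • v e := by
      rw [← Finset.sum_subset (Finset.subset_univ Z) fun e _ he => by simp [he],
        ← Finset.sum_coe_sort Z]
      exact Finset.sum_congr rfl fun e _ => by simp [e.2]
    rwa [h1] at h
  · ext e
    have := congrFun h0 e
    simpa [e.2] using this

lemma eq_sum_of_mem_span {g : K → W} (hg : ∀ i j, β (g i) (g j) = if i = j then 1 else 0)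
    {w : W} (hw : w ∈ Submodule.span ℝ (Set.range g)) : w = ∑ k, β (g k) w • g k := by
  obtain ⟨a, rfl⟩ := (Submodule.mem_span_range_iff_exists_fun ℝ).1 hw
  simp [hg]

lemma genErr_eq_integral (M : Matrix E E ℝ) (u : E → ℝ) :
    genErr M u = ∫ w, ∏ i, Real.sign ((Mᵀ *ᵥ (u + w)) i) ∂gaussMeasure E := by
  rw [integral_gaussMeasure, genErr,
    ← integral_add_left_eq_self (fun u' : E → ℝ => Real.exp _ * _) u]
  congr 1
  ext w
  simp

lemma measurable_sign : Measurable Real.sign := by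
  unfold Real.sign
  exact Measurable.ite measurableSet_Iio measurable_const
    (Measurable.ite measurableSet_Ioi measurable_const measurable_const)

lemma abs_sign_le_one (x : ℝ) : |Real.sign x| ≤ 1 := by
  rcases Real.sign_apply_eq x with h | h | h <;> simp [h]

lemma abs_prod_sign_le_one {ι : Type*} (s : Finset ι) (f : ι → ℝ) :
    |∏ i ∈ s, Real.sign (f i)| ≤ 1 := by
  rw [Finset.abs_prod]
  exact Finset.prod_le_one (fun _ _ => abs_nonneg _) fun _ _ => abs_sign_le_one _

/-- The boosted error function as a Gaussian average, in terms of any orthonormal family whose span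
contains the given vectors. -/
lemma boostedErr_eq_integral (hβ : ∀ x y, β x y = β y x) {v : E → W}
    (hv : ∃ f : E → W, IsOrthonormalFrame (fun x y => β x y) v f) {g : K → W}
    (hg : ∀ i j, β (g i) (g j) = if i = j then 1 else 0)
    (hvg : ∀ e, v e ∈ Submodule.span ℝ (Set.range g)) (x : W) :
    boostedErr (fun x y => β x y) v x =
      ∫ u, ∏ e, Real.sign (β (v e) x + β (v e) (∑ k, u k • g k)) ∂gaussMeasure K := by
  rw [boostedErr, dif_pos hv, genErr_eq_integral]
  obtain ⟨hf1, hf2⟩ := hv.choose_spec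
  set f := hv.choose
  have hfv : ∀ e, v e = ∑ k, β (f k) (v e) • f k := fun e =>
    eq_sum_of_mem_span hf1 (by rw [hf2]; exact Submodule.subset_span ⟨e, rfl⟩)
  have hfg : ∀ k, f k = ∑ j, β (g j) (f k) • g j := fun k => by
    refine eq_sum_of_mem_span hg ?_
    have h1 : f k ∈ Submodule.span ℝ (Set.range v) := by
      rw [← hf2]; exact Submodule.subset_span ⟨k, rfl⟩
    refine (Submodule.span_le.2 ?_) h1
    rintro _ ⟨e, rfl⟩
    exact hvg e
  -- The matrix from `g` to the frame chosen in `boostedErr` has orthonormal rows, so it carries the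
  -- Gaussian measure on `ℝ^K` to the one on `ℝ^E`. This removes the dependence on the choice and
  -- allows `g` to span a larger space.
  set O : Matrix E K ℝ := Matrix.of fun k j => β (f k) (g j) with hO
  have hOO : O * Oᵀ = 1 := by
    ext k l
    have := hf1 k l
    rw [hfg l] at this
    simp only [map_sum, map_smul, smul_eq_mul] at this
    rw [Matrix.one_apply, ← this, Matrix.mul_apply]
    exact Finset.sum_congr rfl fun j _ => by simp [hO, hβ (g j), mul_comm]
  rw [← map_gaussMeasure O hOO, integral_map]
  · congr 1
    ext u
    refine Finset.prod_congr rfl fun e _ => ?_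
    congr 1
    have h1 : ∀ y, ∑ k, β (f k) (v e) * β (f k) y = β (v e) y := by
      intro y
      conv_rhs => rw [hfv e]
      simp
    rw [Matrix.mulVec_add, Pi.add_apply]
    congr 1
    · simp [Matrix.mulVec, dotProduct, h1]
    · simp only [map_sum, map_smul, smul_eq_mul, ← h1]
      simp only [Matrix.mulVec, dotProduct, hO, Matrix.of_apply, Matrix.transpose_apply,
        Finset.mul_sum]
      exact Finset.sum_congr rfl fun j _ => Finset.sum_congr rfl fun i _ => by ring
  · exact Measurable.aemeasurable (by fun_prop)
  · refine (Finset.measurable_prod _ fun i _ => ?_).aestronglyMeasurable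
    exact measurable_sign.comp (by fun_prop)

/-- The coefficients of the functional are the `β w (g k)`, and a vector in the span of `g` for
which all of them vanish is zero. Thus the convention `sgn 0 = 0` plays no role almost surely. -/
lemma ae_form_ne_zero {g : K → W} (hg : ∀ i j, β (g i) (g j) = if i = j then 1 else 0)
    {w : W} (hw : w ∈ Submodule.span ℝ (Set.range g)) (hw0 : w ≠ 0) :
    ∀ᵐ u ∂gaussMeasure K, β w (∑ k, u k • g k) ≠ 0 := by
  refine gaussMeasure_ae_ne (β w ∘ₗ Fintype.linearCombination ℝ g) fun h => hw0 ?_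
  rw [eq_sum_of_mem_span hg hw]
  refine Finset.sum_eq_zero fun k _ => ?_
  have h1 := LinearMap.congr_fun h (Pi.single k 1)
  rw [LinearMap.comp_apply, Fintype.linearCombination_apply_single, one_smul] at h1
  obtain ⟨a, rfl⟩ := (Submodule.mem_span_range_iff_exists_fun ℝ).1 hw
  simp only [map_sum, map_smul, LinearMap.sum_apply, LinearMap.smul_apply, hg, smul_eq_mul] at h1
  simp at h1
  simp [hg, h1]

lemma sign_add_tendsto (a b : ℝ) :
    Tendsto (fun t : ℝ => Real.sign (t * a + b)) atTop
      (𝓝 (if a = 0 then Real.sign b else Real.sign a)) := by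
  split_ifs with h
  · simp [h]
  · refine tendsto_const_nhds.congr' ?_
    rcases lt_or_gt_of_ne h with h | h
    · filter_upwards [eventually_gt_atTop (-b / a)] with t ht
      rw [Real.sign_of_neg h, Real.sign_of_neg]
      rw [div_lt_iff_of_neg h] at ht
      linarith
    · filter_upwards [eventually_gt_atTop (-b / a)] with t ht
      rw [Real.sign_of_pos h, Real.sign_of_pos]
      rw [div_lt_iff₀ h] at ht
      linarith

/-- The limit of a boosted error function along a ray. -/
lemma boostedErr_tendsto (hβ : ∀ x y, β x y = β y x) {v : E → W}
    (hv : ∀ c : E → ℝ, c ≠ 0 → 0 < β (∑ e, c e • v e) (∑ e, c e • v e)) (ξ : W) :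
    Tendsto (fun t : ℝ => boostedErr (fun x y => β x y) v (t • ξ)) atTop
      (𝓝 (∑ J : Finset E, boostedErr (fun x y => β x y) (fun e : J => v e) 0 *
        (∏ e ∈ J, if β (v e) ξ = 0 then (1 : ℝ) else 0) *
        ∏ e ∈ Jᶜ, Real.sign (β (v e) ξ))) := by
  obtain ⟨g, hg1, hg2⟩ := exists_orthonormalFrame hβ v hv
  have hvg : ∀ e, v e ∈ Submodule.span ℝ (Set.range g) := fun e => by
    rw [hg2]; exact Submodule.subset_span ⟨e, rfl⟩
  set Z : Finset E := Finset.univ.filter fun e => β (v e) ξ = 0 with hZ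
  -- Any `J ≠ Z` either contains an edge with nonzero pairing, killed by the delta, or omits one
  -- with zero pairing, killed by `sgn 0 = 0`.
  rw [Finset.sum_eq_single Z]
  rotate_left
  · intro J _ hJ
    rw [mul_assoc, mul_eq_zero]
    right
    by_contra hne
    rw [mul_eq_zero, not_or, ← Ne, ← Ne, Finset.prod_ne_zero_iff, Finset.prod_ne_zero_iff] at hne
    refine hJ (Finset.ext fun e => ?_)
    by_cases he : e ∈ J
    · have := hne.1 e he
      simp_all
    · have := hne.2 e (by simpa using he)
      rw [Ne, Real.sign_eq_zero_iff] at this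
      simp_all
  · simp
  rw [boostedErr_eq_integral hβ (exists_orthonormalFrame_subtype hβ hv Z) hg1 (fun e => hvg e)]
  have h1 : ∏ e ∈ Z, (if β (v e) ξ = 0 then (1 : ℝ) else 0) = 1 :=
    Finset.prod_eq_one fun e he => by simp_all
  rw [h1, mul_one, ← integral_mul_const]
  simp only [boostedErr_eq_integral hβ ⟨g, hg1, hg2⟩ hg1 hvg]
  refine tendsto_integral_filter_of_dominated_convergence (fun _ => 1) ?_ ?_ (by simp) ?_
  · refine Eventually.of_forall fun t => Measurable.aestronglyMeasurable ?_
    refine Finset.measurable_prod _ fun i _ => ?_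
    simp only [map_sum, map_smul, smul_eq_mul]
    exact measurable_sign.comp (by fun_prop)
  · exact Eventually.of_forall fun t => Eventually.of_forall fun u => abs_prod_sign_le_one _ _
  · refine Eventually.of_forall fun u => ?_
    have h2 : (∏ e : Z, Real.sign (β (v e) 0 + β (v e) (∑ k, u k • g k))) *
        ∏ e ∈ Zᶜ, Real.sign (β (v e) ξ) =
        ∏ e, if β (v e) ξ = 0 then Real.sign (β (v e) (∑ k, u k • g k))
          else Real.sign (β (v e) ξ) := by
      rw [← Finset.prod_mul_prod_compl Z, ← Finset.prod_coe_sort Z]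
      congr 1
      · refine Finset.prod_congr rfl fun e _ => ?_
        have := e.2
        simp only [hZ, Finset.mem_filter] at this
        simp [this]
      · refine Finset.prod_congr rfl fun e he => ?_
        simp only [hZ, Finset.mem_compl, Finset.mem_filter, Finset.mem_univ, true_and] at he
        simp [he]
    rw [h2]
    refine tendsto_finsetProd _ fun e _ => ?_
    simpa using sign_add_tendsto (β (v e) ξ) (β (v e) (∑ k, u k • g k))

end Frames

/-! ### Functions of moderate growth and their leading behaviour along a ray -/

section Moderate

variable {W : Type} [NormedAddCommGroup W] [NormedSpace ℝ W]

/-- Smooth functions all of whose derivatives grow at most like `‖x‖ ^ N`. -/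
def Moderate (N : ℕ) (f : W → ℝ) : Prop :=
  ContDiff ℝ ∞ f ∧ ∀ k : ℕ, ∃ C, ∀ x, ‖iteratedFDeriv ℝ k f x‖ ≤ C * (1 + ‖x‖) ^ N

/-- `f` is of moderate growth of order `N` and `f (t ξ) / t ^ N` tends to `A`. -/
def HasLeading (ξ : W) (N : ℕ) (f : W → ℝ) (A : ℝ) : Prop :=
  Moderate N f ∧ Tendsto (fun t : ℝ => f (t • ξ) / t ^ N) atTop (𝓝 A)

lemma Moderate.mono {N M : ℕ} (h : N ≤ M) {f : W → ℝ} (hf : Moderate N f) : Moderate M f := by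
  refine ⟨hf.1, fun k => ?_⟩
  obtain ⟨C, hC⟩ := hf.2 k
  refine ⟨C, fun x => (hC x).trans ?_⟩
  have hC0 : 0 ≤ C := by simpa using (norm_nonneg _).trans (hC 0)
  gcongr
  simp

lemma Moderate.add {N : ℕ} {f g : W → ℝ} (hf : Moderate N f) (hg : Moderate N g) :
    Moderate N (fun x => f x + g x) := by
  refine ⟨hf.1.add hg.1, fun k => ?_⟩
  obtain ⟨C, hC⟩ := hf.2 k
  obtain ⟨D, hD⟩ := hg.2 k
  refine ⟨C + D, fun x => ?_⟩
  have hk : (k : ℕ∞ω) ≤ ∞ := by exact_mod_cast le_top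
  rw [fun_iteratedFDeriv_add (hf.1.of_le hk) (hg.1.of_le hk), add_mul]
  exact (norm_add_le _ _).trans (add_le_add (hC x) (hD x))

lemma Moderate.const_mul {N : ℕ} {f : W → ℝ} (hf : Moderate N f) (c : ℝ) :
    Moderate N (fun x => c * f x) := by
  refine ⟨contDiff_const.mul hf.1, fun k => ?_⟩
  obtain ⟨C, hC⟩ := hf.2 k
  refine ⟨|c| * C, fun x => ?_⟩
  have hk : (k : ℕ∞ω) ≤ ∞ := by exact_mod_cast le_top
  have h := iteratedFDeriv_const_smul_apply (a := c) ((hf.1.of_le hk).contDiffAt (x := x))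
  change ‖iteratedFDeriv ℝ k (c • f) x‖ ≤ _
  rw [h, norm_smul, mul_assoc]
  exact mul_le_mul_of_nonneg_left (hC x) (norm_nonneg _)

lemma Moderate.zero (N : ℕ) : Moderate N (fun _ : W => (0 : ℝ)) :=
  ⟨contDiff_const, fun k => ⟨0, fun x => by simp⟩⟩

/-- The order does not rise because `Moderate` bounds derivatives of every order by the same power.
-/
lemma Moderate.fderiv_apply {N : ℕ} {f : W → ℝ} (hf : Moderate N f) (v : W) :
    Moderate N (fun x => fderiv ℝ f x v) := by
  have hd : ContDiff ℝ ∞ (fderiv ℝ f) := hf.1.fderiv_right (by simp)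
  refine ⟨hd.clm_apply contDiff_const, fun k => ?_⟩
  obtain ⟨C, hC⟩ := hf.2 (k + 1)
  refine ⟨‖v‖ * C, fun x => ?_⟩
  refine (norm_iteratedFDeriv_clm_apply_const (N := ∞) hd.contDiffAt
    (by exact_mod_cast le_top)).trans ?_
  rw [norm_iteratedFDeriv_fderiv, mul_assoc]
  exact mul_le_mul_of_nonneg_left (hC x) (norm_nonneg _)

lemma norm_iteratedFDeriv_linear_le (l : W →L[ℝ] ℝ) (k : ℕ) (x : W) :
    ‖iteratedFDeriv ℝ k l x‖ ≤ ‖l‖ * (1 + ‖x‖) := by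
  rcases k with _ | _ | k
  · rw [norm_iteratedFDeriv_zero]
    refine (l.le_opNorm x).trans ?_
    gcongr
    linarith
  · rw [← norm_iteratedFDeriv_fderiv, norm_iteratedFDeriv_zero, l.fderiv]
    nlinarith [norm_nonneg l, norm_nonneg x]
  · rw [← norm_iteratedFDeriv_fderiv, show fderiv ℝ l = fun _ => l from funext fun _ => l.fderiv,
      iteratedFDeriv_const_of_ne (by omega)]
    simp
    positivity

lemma Moderate.linear_mul {N : ℕ} {f : W → ℝ} (hf : Moderate N f) (l : W →L[ℝ] ℝ) :
    Moderate (N + 1) (fun x => l x * f x) := by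
  refine ⟨l.contDiff.mul hf.1, fun k => ?_⟩
  choose C hC using hf.2
  refine ⟨∑ i ∈ Finset.range (k + 1), k.choose i * ‖l‖ * C (k - i), fun x => ?_⟩
  refine (norm_iteratedFDeriv_mul_le (N := ∞) l.contDiff hf.1 x
    (by exact_mod_cast le_top)).trans ?_
  rw [Finset.sum_mul]
  refine Finset.sum_le_sum fun i _ => ?_
  calc (k.choose i : ℝ) * ‖iteratedFDeriv ℝ i l x‖ * ‖iteratedFDeriv ℝ (k - i) f x‖
      ≤ k.choose i * (‖l‖ * (1 + ‖x‖)) * (C (k - i) * (1 + ‖x‖) ^ N) := by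
        gcongr
        · exact norm_iteratedFDeriv_linear_le l i x
        · exact hC _ x
    _ = _ := by ring

lemma Moderate.tendsto {N : ℕ} {f : W → ℝ} (hf : Moderate N f) (ξ : W) :
    Tendsto (fun t : ℝ => f (t • ξ) / t ^ (N + 1)) atTop (𝓝 0) := by
  obtain ⟨C, hC⟩ := hf.2 0
  have hC0 : 0 ≤ C := by simpa using (norm_nonneg _).trans (hC 0)
  refine squeeze_zero_norm' (a := fun t : ℝ => C * (1 + ‖ξ‖) ^ N / t) ?_
    (tendsto_const_nhds.div_atTop tendsto_id)
  filter_upwards [eventually_ge_atTop 1] with t ht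
  have ht0 : 0 < t := by linarith
  rw [norm_div, norm_pow, Real.norm_of_nonneg ht0.le, pow_succ, ← div_div]
  gcongr
  rw [div_le_iff₀ (by positivity), mul_assoc, ← mul_pow]
  have h := hC (t • ξ)
  rw [norm_iteratedFDeriv_zero] at h
  refine h.trans ?_
  gcongr
  rw [norm_smul, Real.norm_of_nonneg ht0.le]
  nlinarith [norm_nonneg ξ]

lemma HasLeading.add {ξ : W} {N : ℕ} {f g : W → ℝ} {A B : ℝ} (hf : HasLeading ξ N f A)
    (hg : HasLeading ξ N g B) : HasLeading ξ N (fun x => f x + g x) (A + B) :=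
  ⟨hf.1.add hg.1, by simpa only [add_div] using hf.2.add hg.2⟩

lemma HasLeading.const_mul {ξ : W} {N : ℕ} {f : W → ℝ} {A : ℝ} (hf : HasLeading ξ N f A) (c : ℝ) :
    HasLeading ξ N (fun x => c * f x) (c * A) :=
  ⟨hf.1.const_mul c, by simpa only [mul_div_assoc] using hf.2.const_mul c⟩

lemma HasLeading.sum {ξ : W} {N : ℕ} {ι : Type*} (s : Finset ι) {f : ι → W → ℝ} {A : ι → ℝ}
    (h : ∀ i ∈ s, HasLeading ξ N (f i) (A i)) :
    HasLeading ξ N (fun x => ∑ i ∈ s, f i x) (∑ i ∈ s, A i) := by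
  induction s using Finset.induction_on with
  | empty => simpa using ⟨Moderate.zero N, by simp⟩
  | insert a s ha ih =>
    simp only [Finset.sum_insert ha]
    exact (h a (by simp)).add (ih fun i hi => h i (by simp [hi]))

/-- The operator `ℓ + c ∂_v` raises the order by one and multiplies the leading coefficient by
`ℓ ξ`. -/
lemma HasLeading.linear_add_deriv {ξ : W} {N : ℕ} {f : W → ℝ} {A : ℝ} (hf : HasLeading ξ N f A)
    (l : W →L[ℝ] ℝ) (c : ℝ) (v : W) :
    HasLeading ξ (N + 1) (fun x => l x * f x + c * fderiv ℝ f x v) (l ξ * A) := by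
  rw [← add_zero (l ξ * A)]
  -- The derivative term still has order `N`, so it disappears after division by `t ^ (N + 1)`.
  have hd : Moderate N fun x => c * fderiv ℝ f x v := (hf.1.fderiv_apply v).const_mul c
  refine HasLeading.add ⟨hf.1.linear_mul l, ?_⟩ ⟨hd.mono N.le_succ, hd.tendsto ξ⟩
  refine (hf.2.const_mul (l ξ)).congr' ?_
  filter_upwards [eventually_gt_atTop 0] with t ht
  rw [map_smul, smul_eq_mul]
  field_simp
  ring

/-- Composition of operators which multiply the leading coefficients by `a e`. -/
lemma HasLeading.opProd {E : Type} [Fintype E] {ξ : W} (op : E → (W → ℝ) → W → ℝ) (d : E → ℕ)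
    (a : E → ℝ) (hop : ∀ e N f A, HasLeading ξ N f A → HasLeading ξ (N + d e) (op e f) (a e * A))
    {N : ℕ} {f : W → ℝ} {A : ℝ} (hf : HasLeading ξ N f A) :
    HasLeading ξ (N + ∑ e, d e) (opProd op f) ((∏ e, a e) * A) := by
  -- The list order in `opProd` is unspecified, so the induction covers all lists. The resulting
  -- coefficient is a commutative product and forgets the order.
  have key : ∀ l : List E, HasLeading ξ (N + (l.map d).sum)
      ((l.map op).foldr (fun D g => D g) f) ((l.map a).prod * A) := by
    intro l
    induction l with
    | nil => simpa using hf
    | cons e l ih =>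
      simp only [List.map_cons, List.sum_cons, List.prod_cons, List.foldr_cons]
      rw [mul_assoc, add_comm (d e), ← add_assoc]
      exact hop e _ _ _ ih
  have h := key Finset.univ.toList
  rwa [Finset.sum_map_toList, Finset.prod_map_toList] at h

lemma genErr_eq_smoothing {E : Type} [Fintype E] (M : Matrix E E ℝ) (u : E → ℝ) :
    genErr M u = smoothing volume (fun w => ∏ i, Real.sign ((Mᵀ *ᵥ w) i)) (gaussSchwartz E) u := by
  rw [genErr, smoothing]
  congr 1
  ext w
  rw [smul_eq_mul, mul_comm]
  rfl

/-- Derivatives of a smoothing of a bounded function are bounded, and composition with `L` costs a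
factor `‖L‖ ^ k`; hence order zero. -/
lemma moderate_genErr {E : Type} [Fintype E] (M : Matrix E E ℝ) (L : W →L[ℝ] (E → ℝ)) :
    Moderate 0 fun x => genErr M (L x) := by
  have hs : Measurable fun w : E → ℝ => ∏ i, Real.sign ((Mᵀ *ᵥ w) i) :=
    Finset.measurable_prod _ fun i _ => measurable_sign.comp (by fun_prop)
  have hs1 : ∀ w : E → ℝ, |∏ i, Real.sign ((Mᵀ *ᵥ w) i)| ≤ 1 := fun w =>
    abs_prod_sign_le_one _ _
  have hsm : ContDiff ℝ ∞ (genErr M) := by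
    rw [funext (genErr_eq_smoothing M)]
    exact contDiff_infty.2 fun k => smoothing_contDiff hs hs1 k _
  refine ⟨hsm.comp L.contDiff, fun k => ?_⟩
  obtain ⟨C, hC⟩ := smoothing_iteratedFDeriv_bounded (μ := volume) hs hs1 k (gaussSchwartz E)
  refine ⟨C * ‖L‖ ^ k, fun x => ?_⟩
  have hk : (k : ℕ∞ω) ≤ ∞ := by exact_mod_cast le_top
  change ‖iteratedFDeriv ℝ k (genErr M ∘ L) x‖ ≤ _
  rw [L.iteratedFDeriv_comp_right hsm x hk, pow_zero, mul_one]
  refine (ContinuousMultilinearMap.norm_compContinuousLinearMap_le _ _).trans ?_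
  rw [Finset.prod_const, Finset.card_univ, Fintype.card_fin]
  gcongr
  rw [funext (genErr_eq_smoothing M)]
  exact hC _

lemma moderate_boostedErr [FiniteDimensional ℝ W] {E : Type} [Fintype E]
    (β : LinearMap.BilinForm ℝ W) (v : E → W) : Moderate 0 (boostedErr (fun x y => β x y) v) := by
  unfold boostedErr
  split_ifs with h
  · have := moderate_genErr (Matrix.of fun k i => β (h.choose k) (v i))
      (LinearMap.toContinuousLinearMap (LinearMap.pi fun k => β (h.choose k)))
    exact this
  · exact Moderate.zero 0

/-- The leading behaviour of a boosted error function along a ray. -/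
lemma hasLeading_boostedErr [FiniteDimensional ℝ W] {E : Type} [Fintype E]
    {β : LinearMap.BilinForm ℝ W} (hβ : ∀ x y, β x y = β y x) {v : E → W}
    (hv : ∀ c : E → ℝ, c ≠ 0 → 0 < β (∑ e, c e • v e) (∑ e, c e • v e)) (ξ : W) :
    HasLeading ξ 0 (boostedErr (fun x y => β x y) v)
      (∑ J : Finset E, boostedErr (fun x y => β x y) (fun e : J => v e) 0 *
        (∏ e ∈ J, if β (v e) ξ = 0 then (1 : ℝ) else 0) *
        ∏ e ∈ Jᶜ, Real.sign (β (v e) ξ)) :=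
  ⟨moderate_boostedErr β v, by simpa using boostedErr_tendsto hβ hv ξ⟩

end Moderate

/-! ### Intersection forms -/

section Cubic

variable {b : ℕ}

/-- The cubic form on real classes, as a trilinear map. -/
def tri (κ : Fin b → Fin b → Fin b → ℤ) :
    (Fin b → ℝ) →ₗ[ℝ] (Fin b → ℝ) →ₗ[ℝ] (Fin b → ℝ) →ₗ[ℝ] ℝ :=
  ∑ i, ∑ j, ∑ k, (κ i j k : ℝ) • (LinearMap.proj i : (Fin b → ℝ) →ₗ[ℝ] ℝ).smulRight
    ((LinearMap.proj j : (Fin b → ℝ) →ₗ[ℝ] ℝ).smulRight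
      (LinearMap.proj k : (Fin b → ℝ) →ₗ[ℝ] ℝ))

lemma tri_apply (κ : Fin b → Fin b → Fin b → ℤ) (x y z : Fin b → ℝ) :
    tri κ x y z = ∑ i, ∑ j, ∑ k, (κ i j k : ℝ) * x i * y j * z k := by
  simp only [tri, LinearMap.sum_apply, LinearMap.smul_apply, LinearMap.smulRight_apply,
    LinearMap.proj_apply, smul_eq_mul]
  exact Finset.sum_congr rfl fun i _ => Finset.sum_congr rfl fun j _ =>
    Finset.sum_congr rfl fun k _ => by ring

/-- The real vector of an integer class. -/
def rvec (p : Fin b → ℤ) : Fin b → ℝ := fun a => p a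

lemma tri_rvec (κ : Fin b → Fin b → Fin b → ℤ) (p q r : Fin b → ℤ) :
    tri κ (rvec p) (rvec q) (rvec r) = cubic κ p q r := by
  simp [tri_apply, cubic, rvec]

lemma kappaMat_form (κ : Fin b → Fin b → Fin b → ℤ) (p : Fin b → ℤ) (x y : Fin b → ℝ) :
    ∑ a, ∑ c, kappaMat κ p a c * x a * y c = tri κ x y (rvec p) := by
  rw [tri_apply]
  refine Finset.sum_congr rfl fun i _ => Finset.sum_congr rfl fun j _ => ?_
  simp only [kappaMat, Matrix.of_apply, rvec, Finset.sum_mul]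
  exact Finset.sum_congr rfl fun k _ => by ring

lemma quadForm_kappaMat (κ : Fin b → Fin b → Fin b → ℤ) (p : Fin b → ℤ) (x : Fin b → ℝ) :
    (kappaMat κ p).toQuadraticForm' x = tri κ x x (rvec p) := by
  rw [← kappaMat_form, Matrix.toQuadraticForm', LinearMap.BilinMap.toQuadraticMap_apply,
    Matrix.toLinearMap₂'_apply]
  exact Finset.sum_congr rfl fun i _ => Finset.sum_congr rfl fun j _ => by
    simp only [smul_eq_mul]; ring

variable (X : IntersectionData b)

lemma tri_swap_left (x y z : Fin b → ℝ) : tri X.κ x y z = tri X.κ y x z := by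
  rw [tri_apply, tri_apply, Finset.sum_comm]
  exact Finset.sum_congr rfl fun i _ => Finset.sum_congr rfl fun j _ =>
    Finset.sum_congr rfl fun k _ => by rw [X.κ_swap_left]; ring

lemma tri_swap_right (x y z : Fin b → ℝ) : tri X.κ x y z = tri X.κ x z y := by
  rw [tri_apply, tri_apply]
  refine Finset.sum_congr rfl fun i _ => ?_
  rw [Finset.sum_comm]
  exact Finset.sum_congr rfl fun j _ => Finset.sum_congr rfl fun k _ => by
    rw [X.κ_swap_right]; ring

variable {X}

/-- The reversed Cauchy-Schwarz inequality for the Lorentzian form `κ_{abc} p^c`. -/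
lemma tri_hodge_index {p : Fin b → ℤ} (hp : InChargeCone X.κ X.effDiv X.effCurve p)
    (w : Fin b → ℝ) :
    tri X.κ (rvec p) (rvec p) (rvec p) * tri X.κ w w (rvec p) ≤
      tri X.κ w (rvec p) (rvec p) ^ 2 := by
  by_contra! hlt
  set P := rvec p
  set α := tri X.κ P P P
  set μ := tri X.κ w P P
  set ν := tri X.κ w w P
  have hα : 0 < α := by
    have := hp.1
    simp only [α, P, tri_rvec]
    exact_mod_cast this
  have hq : ∀ s t : ℝ, tri X.κ (s • P + t • w) (s • P + t • w) P =
      s ^ 2 * α + 2 * s * t * μ + t ^ 2 * ν := by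
    intro s t
    simp only [map_add, map_smul, LinearMap.add_apply, LinearMap.smul_apply, smul_eq_mul,
      tri_swap_left X P w P]
    ring
  -- If the inequality failed, completing the square would make the form positive definite on the
  -- plane spanned by `P` and `w`, against `sigPos = 1`.
  have hpos : ∀ s t : ℝ, (s ≠ 0 ∨ t ≠ 0) → 0 < s ^ 2 * α + 2 * s * t * μ + t ^ 2 * ν := by
    intro s t hst
    have h1 : α * (s ^ 2 * α + 2 * s * t * μ + t ^ 2 * ν) =
        (s * α + t * μ) ^ 2 + t ^ 2 * (α * ν - μ ^ 2) := by ring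
    have h2 : 0 < α * (s ^ 2 * α + 2 * s * t * μ + t ^ 2 * ν) := by
      rw [h1]
      by_cases ht : t = 0
      · subst ht
        have hs : s ≠ 0 := by simpa using hst
        have : 0 < (s * α) ^ 2 := by positivity
        simpa using this
      · have h3 : 0 < t ^ 2 := by positivity
        have h4 : 0 < t ^ 2 * (α * ν - μ ^ 2) := mul_pos h3 (by linarith)
        have h5 := sq_nonneg (s * α + t * μ)
        linarith
    exact pos_of_mul_pos_right h2 hα.le
  have hli : LinearIndependent ℝ ![P, w] := by
    rw [LinearIndependent.pair_iff]
    intro s t h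
    by_contra hne
    have h1 := hpos s t (by tauto)
    rw [← hq, h] at h1
    simp at h1
  have hfin := finrank_span_eq_card hli
  have hle : Module.finrank ℝ (Submodule.span ℝ (Set.range ![P, w])) ≤
      sigPos (kappaMat X.κ p).toQuadraticForm' := by
    refine le_sigPos_of_posDef _ ?_
    rintro ⟨x, hx'⟩ hx
    rw [QuadraticMap.restrict_apply, quadForm_kappaMat]
    rw [Matrix.range_cons, Matrix.range_cons, Matrix.range_empty, Set.union_empty,
      Set.singleton_union, Submodule.mem_span_pair] at hx'
    obtain ⟨s, t, hst⟩ := hx'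
    change 0 < tri X.κ x x P
    rw [← hst, hq]
    refine hpos s t ?_
    by_contra! h
    refine hx (Subtype.ext ?_)
    simp [← hst, h.1, h.2]
  rw [hfin, X.signature_pos p hp] at hle
  simp at hle

/-- The two signature numbers add up to `b`, so the radical is zero, while a kernel vector of the
matrix would lie in the radical. -/
lemma isUnit_det_kappaMat {p : Fin b → ℤ} (hp : InChargeCone X.κ X.effDiv X.effCurve p) :
    IsUnit (kappaMat X.κ p).det := by
  have h := QuadraticForm.sigPos_add_sigNeg_add_radical (Q := (kappaMat X.κ p).toQuadraticForm')
  have h1 := X.signature_pos p hp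
  have h2 := X.signature_neg p hp
  rw [Module.finrank_fin_fun] at h
  have h3 : Module.finrank ℝ (kappaMat X.κ p).toQuadraticForm'.radical = 0 := by omega
  rw [Submodule.finrank_eq_zero] at h3
  rw [isUnit_iff_ne_zero]
  intro hdet
  obtain ⟨x, hx0, hx⟩ := Matrix.exists_mulVec_eq_zero_iff.2 hdet
  have hz : ∀ y, tri X.κ y x (rvec p) = 0 := by
    intro y
    rw [← kappaMat_form]
    refine Finset.sum_eq_zero fun a _ => ?_
    have h4 := congrFun hx a
    simp only [Matrix.mulVec, dotProduct, Pi.zero_apply] at h4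
    calc ∑ c, kappaMat X.κ p a c * y a * x c = y a * ∑ c, kappaMat X.κ p a c * x c := by
          rw [Finset.mul_sum]; exact Finset.sum_congr rfl fun _ _ => by ring
      _ = 0 := by rw [h4, mul_zero]
  refine hx0 ?_
  rw [← Submodule.mem_bot ℝ, ← h3, QuadraticMap.mem_radical_iff']
  refine ⟨by rw [quadForm_kappaMat, hz], fun y => ?_⟩
  simp only [quadForm_kappaMat, map_add, LinearMap.add_apply, hz,
    tri_swap_left X x y]
  ring

end Cubic

/-! ### The form on families of classes and its positivity on edge vectors. -/

section Form

variable {b n : ℕ} {X : IntersectionData b} (γ : Fin n → Charge X)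

/-- The form `x · y` as a bilinear form. -/
def formB : LinearMap.BilinForm ℝ (Fin n → Fin b → ℝ) :=
  ∑ i, ((tri X.κ).compl₁₂ (LinearMap.proj i) (LinearMap.proj i)).compr₂
    (LinearMap.applyₗ (rvec (γ i).p))

lemma formB_apply (x y : Fin n → Fin b → ℝ) :
    formB γ x y = ∑ i, tri X.κ (x i) (y i) (rvec (γ i).p) := by
  simp [formB, LinearMap.sum_apply]

lemma biform_eq : biform γ = fun x y => formB γ x y := by
  ext x y
  rw [formB_apply]
  exact Finset.sum_congr rfl fun i _ => kappaMat_form _ _ _ _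

lemma formB_comm (x y : Fin n → Fin b → ℝ) : formB γ x y = formB γ y x := by
  simp only [formB_apply]
  exact Finset.sum_congr rfl fun i _ => tri_swap_left X _ _ _

/-- The direction `κ_i^{ab} q_{i,b}` of the points `point γ τ₂`. -/
def ray : Fin n → Fin b → ℝ := fun i => (kappaMat X.κ (γ i).p)⁻¹ *ᵥ (γ i).q

/-- The matrix `κ_i` in the form cancels the `κ_i⁻¹` in the ray, which turns the form into the plain
pairing with `q`. -/
lemma formB_ray (x : Fin n → Fin b → ℝ) : formB γ x (ray γ) = ∑ i, ∑ a, x i a * (γ i).q a := by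
  rw [formB_apply]
  refine Finset.sum_congr rfl fun i _ => ?_
  rw [← kappaMat_form]
  refine Finset.sum_congr rfl fun a _ => ?_
  have h : kappaMat X.κ (γ i).p *ᵥ ray γ i = (γ i).q := by
    rw [ray, Matrix.mulVec_mulVec, Matrix.mul_nonsing_inv _ (isUnit_det_kappaMat (γ i).p_mem),
      Matrix.one_mulVec]
  rw [← congrFun h a, Matrix.mulVec, dotProduct, Finset.mul_sum]
  exact Finset.sum_congr rfl fun _ _ => by ring

lemma formB_vec_ray (i j : Fin n) : formB γ (vec γ i j) (ray γ) = dirac γ i j := by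
  rw [formB_ray, Finset.sum_comm, dirac]
  refine Finset.sum_congr rfl fun a _ => ?_
  simp [vec, sub_mul, Finset.sum_sub_distrib]

/-- The total D4-brane charge. -/
def totalP : Fin b → ℤ := ∑ i, (γ i).p

lemma totalP_mem [Nonempty (Fin n)] : InChargeCone X.κ X.effDiv X.effCurve (totalP γ) :=
  Finset.sum_induction_nonempty _ _ X.cone_add Finset.univ_nonempty fun i _ => (γ i).p_mem

/-- The vector with components `∑_j (φ_i - φ_j) p_j`. -/
def chi : (Fin n → ℝ) →ₗ[ℝ] (Fin n → Fin b → ℝ) where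
  toFun φ := fun i => ∑ j, (φ i - φ j) • rvec (γ j).p
  map_add' φ ψ := by
    ext i a
    simp only [Pi.add_apply, Finset.sum_apply, Pi.smul_apply, smul_eq_mul, ← Finset.sum_add_distrib]
    exact Finset.sum_congr rfl fun _ _ => by ring
  map_smul' s φ := by
    ext i a
    simp only [Pi.smul_apply, Finset.sum_apply, smul_eq_mul, Finset.mul_sum, RingHom.id_apply]
    exact Finset.sum_congr rfl fun _ _ => by ring

lemma chi_apply (φ : Fin n → ℝ) (i : Fin n) :
    chi γ φ i = φ i • rvec (totalP γ) - ∑ j, φ j • rvec (γ j).p := by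
  have h : rvec (totalP γ) = ∑ j, rvec (γ j).p := by
    ext a
    simp [rvec, totalP]
  simp [chi, h, sub_smul, Finset.sum_sub_distrib, Finset.smul_sum]

lemma chi_eq_zero {φ : Fin n → ℝ} (h : ∀ i j, φ i = φ j) : chi γ φ = 0 := by
  ext i a
  simp [chi, fun j => sub_eq_zero.2 (h i j)]

/-- With `w = ∑ φ_j p_j` and `P = ∑ p_i`, the `i`-th component of `chi φ` is `φ_i P - w`. Summed
over `i`, the mixed terms give `-2 (wwP)` and the terms in `w²` give `+(wwP)`. -/
lemma formB_chi (φ : Fin n → ℝ) : formB γ (chi γ φ) (chi γ φ) =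
    ∑ i, φ i ^ 2 * tri X.κ (rvec (γ i).p) (rvec (totalP γ)) (rvec (totalP γ)) -
      tri X.κ (∑ j, φ j • rvec (γ j).p) (∑ j, φ j • rvec (γ j).p) (rvec (totalP γ)) := by
  set P := rvec (totalP γ) with hP
  set w := ∑ j, φ j • rvec (γ j).p with hw
  have hP' : P = ∑ j, rvec (γ j).p := by
    ext a
    simp [hP, rvec, totalP]
  have h1 : ∀ i, tri X.κ (chi γ φ i) (chi γ φ i) (rvec (γ i).p) =
      φ i ^ 2 * tri X.κ (rvec (γ i).p) P P - 2 * tri X.κ w P (φ i • rvec (γ i).p) +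
        tri X.κ w w (rvec (γ i).p) := by
    intro i
    rw [chi_apply]
    simp only [map_sub, map_smul, LinearMap.sub_apply, LinearMap.smul_apply, smul_eq_mul]
    rw [tri_swap_left X P w, tri_swap_right X P P, tri_swap_left X P]
    ring
  rw [formB_apply, Finset.sum_congr rfl fun i _ => h1 i, Finset.sum_add_distrib,
    Finset.sum_sub_distrib, ← Finset.mul_sum, ← map_sum, ← map_sum, ← hw, ← hP',
    tri_swap_right X w P w]
  ring

/-- The form is positive on `chi φ` unless `φ` is constant. -/
lemma formB_chi_pos {φ : Fin n → ℝ} {i₀ j₀ : Fin n} (h : φ i₀ ≠ φ j₀) :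
    0 < formB γ (chi γ φ) (chi γ φ) := by
  have : Nonempty (Fin n) := ⟨i₀⟩
  rw [formB_chi]
  have hodge := tri_hodge_index (totalP_mem γ) (∑ j, φ j • rvec (γ j).p)
  have hcone := totalP_mem γ
  set P := rvec (totalP γ) with hP
  set w := ∑ j, φ j • rvec (γ j).p with hw
  set m : Fin n → ℝ := fun i => tri X.κ (rvec (γ i).p) P P with hm
  have hP' : P = ∑ j, rvec (γ j).p := by
    ext a
    simp [hP, rvec, totalP]
  have hmpos : ∀ i, 0 < m i := fun i => by
    have := hcone.2.1 _ (X.cone_effective _ (γ i).p_mem)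
    simp only [hm, hP, tri_rvec]
    exact_mod_cast this
  have hPP : tri X.κ P P P = ∑ i, m i := by
    calc tri X.κ P P P = tri X.κ (∑ j, rvec (γ j).p) P P := by rw [← hP']
      _ = _ := by rw [map_sum, LinearMap.sum_apply, LinearMap.sum_apply]
  have hwP : tri X.κ w P P = ∑ i, φ i * m i := by
    rw [hw, map_sum, LinearMap.sum_apply, LinearMap.sum_apply]
    exact Finset.sum_congr rfl fun i _ => by simp [hm]
  rw [hPP, hwP] at hodge
  change 0 < ∑ i, φ i ^ 2 * m i - _
  have hM : 0 < ∑ i, m i := Finset.sum_pos (fun i _ => hmpos i) Finset.univ_nonempty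
  -- After multiplication by `∑ m_i = P³`, the Hodge inequality replaces `(wwP)` by `(∑ φ_i m_i)²`.
  -- What remains is the Lagrange identity for weights `m_i`.
  have hexp : ∑ i, ∑ j, m i * m j * (φ i - φ j) ^ 2 =
      2 * ((∑ i, m i) * (∑ i, φ i ^ 2 * m i) - (∑ i, φ i * m i) ^ 2) := by
    have e1 : ∑ i, ∑ j, m i * (φ j ^ 2 * m j) = (∑ i, m i) * (∑ i, φ i ^ 2 * m i) := by
      rw [Finset.sum_mul_sum]
    have e2 : ∑ i, ∑ j, (φ i ^ 2 * m i) * m j = (∑ i, m i) * (∑ i, φ i ^ 2 * m i) := by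
      rw [← Finset.sum_mul_sum, mul_comm]
    have e3 : ∑ i, ∑ j, 2 * ((φ i * m i) * (φ j * m j)) = 2 * (∑ i, φ i * m i) ^ 2 := by
      rw [sq, Finset.sum_mul_sum]
      simp only [Finset.mul_sum]
    calc _ = ∑ i, ∑ j, (m i * (φ j ^ 2 * m j) + (φ i ^ 2 * m i) * m j -
          2 * ((φ i * m i) * (φ j * m j))) :=
          Finset.sum_congr rfl fun _ _ => Finset.sum_congr rfl fun _ _ => by ring
      _ = _ := by
          simp only [Finset.sum_sub_distrib, Finset.sum_add_distrib, e1, e2, e3]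
          ring
  have hlt : 0 < ∑ i, ∑ j, m i * m j * (φ i - φ j) ^ 2 := by
    have hnn : ∀ i j, 0 ≤ m i * m j * (φ i - φ j) ^ 2 := fun i j =>
      mul_nonneg (mul_pos (hmpos i) (hmpos j)).le (sq_nonneg _)
    refine Finset.sum_pos' (fun i _ => Finset.sum_nonneg fun j _ => hnn i j)
      ⟨i₀, Finset.mem_univ _, Finset.sum_pos' (fun j _ => hnn i₀ j) ⟨j₀, Finset.mem_univ _, ?_⟩⟩
    exact mul_pos (mul_pos (hmpos _) (hmpos _)) (by have := sub_ne_zero.2 h; positivity)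
  rw [hexp] at hlt
  refine pos_of_mul_pos_right (a := ∑ i, m i) ?_ hM.le
  rw [mul_sub]
  linarith

end Form

/-! ### Trees -/

namespace OGraph

section Linked

variable {V E : Type} {T : OGraph V E}

lemma Linked.refl (A : Set E) (u : V) : T.Linked A u u := Relation.EqvGen.refl u

lemma Linked.symm {A : Set E} {u v : V} (h : T.Linked A u v) : T.Linked A v u :=
  Relation.EqvGen.symm _ _ h

lemma Linked.trans {A : Set E} {u v w : V} (h : T.Linked A u v) (h' : T.Linked A v w) :
    T.Linked A u w := Relation.EqvGen.trans _ _ _ h h'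

lemma Linked.edge {A : Set E} {e : E} (he : e ∈ A) : T.Linked A (T.src e) (T.tgt e) :=
  Relation.EqvGen.rel _ _ ⟨e, he, rfl, rfl⟩

/-- A function which agrees at the ends of all edges in `A` is constant on components. -/
lemma Linked.eq_of_forall {A : Set E} {α : Sort*} {f : V → α}
    (hf : ∀ e ∈ A, f (T.src e) = f (T.tgt e)) {u v : V} (h : T.Linked A u v) : f u = f v := by
  induction h with
  | rel _ _ h =>
    obtain ⟨e, he, rfl, rfl⟩ := h
    exact hf e he
  | refl => rfl
  | symm _ _ _ ih => exact ih.symm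
  | trans _ _ _ _ _ ih ih' => exact ih.trans ih'

lemma Linked.of_edges {V' E' : Type} {T' : OGraph V' E'} {A : Set E} {A' : Set E'} (f : V → V')
    (hf : ∀ e ∈ A, T'.Linked A' (f (T.src e)) (f (T.tgt e))) {u v : V} (h : T.Linked A u v) :
    T'.Linked A' (f u) (f v) := by
  induction h with
  | rel _ _ h =>
    obtain ⟨e, he, rfl, rfl⟩ := h
    exact hf e he
  | refl => exact Linked.refl _ _
  | symm _ _ _ ih => exact ih.symm
  | trans _ _ _ _ _ ih ih' => exact ih.trans ih'

lemma Linked.mono {A A' : Set E} (hA : A ⊆ A') {u v : V} (h : T.Linked A u v) :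
    T.Linked A' u v :=
  h.of_edges id fun _ he => Linked.edge (hA he)

variable (T) in
/-- `S` is one of the two parts into which the removal of `e` cuts the graph, the one containing the
source of `e`. -/
def Cuts (e : E) (S : Set V) : Prop :=
  T.src e ∈ S ∧ T.tgt e ∉ S ∧ ∀ e', e' ≠ e → (T.src e' ∈ S ↔ T.tgt e' ∈ S)

lemma cuts_srcSide (hT : T.IsTree) (e : E) : T.Cuts e (T.srcSide e) := by
  refine ⟨Linked.refl _ _, hT.2.2 e, fun e' he' => ?_⟩
  have h : T.Linked {e}ᶜ (T.src e') (T.tgt e') := Linked.edge he'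
  exact ⟨fun h' => Linked.trans h' h, fun h' => Linked.trans h' h.symm⟩

/-- Lying on one of the two sides is preserved along every edge, so connectedness puts each vertex
on a side; a vertex on both would link the ends of `e` without `e`. -/
lemma tgtSide_eq (hT : T.IsTree) (e : E) : T.tgtSide e = (T.srcSide e)ᶜ := by
  ext v
  constructor
  · intro h h'
    exact hT.2.2 e (Linked.trans h' (Linked.symm h))
  · intro h
    have h1 := Linked.eq_of_forall (T := T) (A := Set.univ)
      (f := fun w => w ∈ T.srcSide e ∨ w ∈ T.tgtSide e) (fun e' _ => ?_) (hT.2.1 (T.src e) v)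
    · have h2 : v ∈ T.srcSide e ∨ v ∈ T.tgtSide e := by
        rw [← h1]
        exact Or.inl (Linked.refl _ _)
      exact h2.resolve_left h
    · by_cases he : e' = e
      · subst he
        exact propext ⟨fun _ => Or.inr (Linked.refl _ _), fun _ => Or.inl (Linked.refl _ _)⟩
      · have h : T.Linked {e}ᶜ (T.src e') (T.tgt e') := Linked.edge he
        exact propext ⟨Or.imp (fun h' => Linked.trans h' h) (fun h' => Linked.trans h' h),
          Or.imp (fun h' => Linked.trans h' h.symm) (fun h' => Linked.trans h' h.symm)⟩

/-- A cut is determined by its edge. -/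
lemma srcSide_eq_of_cuts (hT : T.IsTree) {e : E} {S : Set V} (hS : T.Cuts e S) :
    T.srcSide e = S := by
  have key : ∀ {u v}, T.Linked {e}ᶜ u v → (u ∈ S ↔ v ∈ S) := fun h =>
    iff_of_eq (Linked.eq_of_forall (f := fun w => w ∈ S) (fun e' he' =>
      propext (hS.2.2 e' he')) h)
  ext v
  constructor
  · exact fun h => (key h).1 hS.1
  · intro hv
    by_contra hn
    have h : v ∈ T.tgtSide e := by rw [tgtSide_eq hT]; exact hn
    exact hS.2.1 ((key h).2 hv)

/-- A cut certifies that `e` is a bridge, and does so without assuming a tree; this is how glued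
graphs are shown to be trees. -/
lemma not_linked_of_cuts {e : E} {S : Set V} (hS : T.Cuts e S) :
    ¬ T.Linked {e}ᶜ (T.src e) (T.tgt e) := fun h =>
  hS.2.1 ((iff_of_eq (Linked.eq_of_forall (f := fun w => w ∈ S) (fun e' he' =>
      propext (hS.2.2 e' he')) h)).1 hS.1)

/-- Only edges outside `J` are contracted, and `e` is not one of them, so identified vertices are
already linked in the absence of `e`. -/
lemma contract_linked_iff (J : Finset E) (e : J) (u v : V) :
    (T.contract J).Linked {e}ᶜ (Quotient.mk (T.contractSetoid J) u)
      (Quotient.mk (T.contractSetoid J) v) ↔ T.Linked {e.1}ᶜ u v := by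
  constructor
  · intro h
    have hJ : {e' | e' ∉ J} ⊆ ({e.1}ᶜ : Set E) := fun e' he' h => he' (by
      rw [Set.mem_singleton_iff] at h; rw [h]; exact e.2)
    have hmk : ∀ {u v : V}, Quotient.mk (T.contractSetoid J) u =
        Quotient.mk (T.contractSetoid J) v → T.Linked {e.1}ᶜ u v := fun h =>
      Linked.mono hJ (Quotient.exact h)
    have key : ∀ q q', (T.contract J).Linked {e}ᶜ q q' → ∀ u v,
        Quotient.mk (T.contractSetoid J) u = q → Quotient.mk (T.contractSetoid J) v = q' →
        T.Linked {e.1}ᶜ u v := by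
      intro q q' h
      induction h with
      | rel _ _ h =>
        obtain ⟨e', he', rfl, rfl⟩ := h
        intro u v hu hv
        have h1 : T.Linked {e.1}ᶜ (T.src e'.1) (T.tgt e'.1) :=
          Linked.edge fun h => he' (Subtype.ext h)
        exact ((hmk hu).trans h1).trans (hmk hv).symm
      | refl => exact fun u v hu hv => hmk (hu.trans hv.symm)
      | symm _ _ _ ih => exact fun u v hu hv => (ih v u hv hu).symm
      | trans _ y _ _ _ ih ih' =>
        intro u v hu hv
        obtain ⟨w, rfl⟩ := Quotient.exists_rep y
        exact (ih u w hu rfl).trans (ih' w v rfl hv)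
    exact key _ _ h u v rfl rfl
  · refine Linked.of_edges _ fun e' he' => ?_
    by_cases hJ : e' ∈ J
    · exact Linked.edge (T := T.contract J) (e := ⟨e', hJ⟩) fun h => he' (congrArg Subtype.val h)
    · have h : Quotient.mk (T.contractSetoid J) (T.src e') =
          Quotient.mk (T.contractSetoid J) (T.tgt e') :=
        Quotient.sound (Linked.edge (A := {e | e ∉ J}) hJ)
      rw [h]
      exact Linked.refl _ _

end Linked

/-! ### Edge vectors of trees as images of indicator functions. -/

section Vectors

variable {V E : Type} {T : OGraph V E} {b n : ℕ} {X : IntersectionData b} (γ : Fin n → Charge X)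
  (c : Fin n → V)

/-- The indicator function of a set of vertices, as a function of the labels. -/
def indic (S : Set V) : Fin n → ℝ := fun i => if c i ∈ S then 1 else 0

/-- At `k` in `s` only the first delta survives and gives the sum of `p_j` over the complement; at
`k` outside `s` only the second does and gives minus the sum over `s`. -/
lemma sum_vec_eq_chi (s : Fin n → Prop) :
    ∑ i with s i, ∑ j with ¬ s j, vec γ i j = chi γ fun i => if s i then 1 else 0 := by
  ext k a
  have h1 : ∀ i j, vec γ i j k a =
      (if k = i then ((γ j).p a : ℝ) else 0) - (if k = j then ((γ i).p a : ℝ) else 0) :=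
    fun _ _ => rfl
  simp only [Finset.sum_apply, h1, Finset.sum_sub_distrib, chi, LinearMap.coe_mk, AddHom.coe_mk,
    Pi.smul_apply, smul_eq_mul, rvec]
  rw [Finset.sum_comm (s := Finset.univ.filter s)]
  simp only [Finset.sum_ite_eq, Finset.mem_filter, Finset.mem_univ, true_and]
  by_cases hk : s k
  · simp only [hk, if_true, not_true_eq_false, if_false, Finset.sum_const_zero, sub_zero,
      Finset.sum_filter]
    exact Finset.sum_congr rfl fun j _ => by split_ifs <;> simp_all
  · simp only [hk, if_false, not_false_eq_true, if_true, Finset.sum_const_zero, zero_sub,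
      Finset.sum_filter, ← Finset.sum_neg_distrib]
    exact Finset.sum_congr rfl fun j _ => by split_ifs <;> simp_all

lemma edgeVec_eq_chi (hT : T.IsTree) (e : E) :
    T.edgeVec γ c e = chi γ (indic c (T.srcSide e)) := by
  rw [edgeVec, tgtSide_eq hT]
  simp only [Set.mem_compl_iff]
  exact sum_vec_eq_chi γ fun i => c i ∈ T.srcSide e

lemma formB_edgeVec_ray (e : E) : formB γ (T.edgeVec γ c e) (ray γ) = T.edgeDirac γ c e := by
  simp only [edgeVec, edgeDirac, map_sum, LinearMap.sum_apply, formB_vec_ray]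

lemma formB_endVec_ray (e : E) : formB γ (T.endVec γ c e) (ray γ) = T.endDirac γ c e := by
  simp only [endVec, endDirac, map_sum, LinearMap.sum_apply, formB_vec_ray]

variable {γ c}

/-- The vectors of the edges of a tree are independent and span a positive definite subspace. -/
lemma edgeVec_pos [Fintype E] (hT : T.IsTree) (hc : Function.Surjective c) (a : E → ℝ)
    (ha : a ≠ 0) :
    0 < formB γ (∑ e, a e • T.edgeVec γ c e) (∑ e, a e • T.edgeVec γ c e) := by
  obtain ⟨e, he⟩ := Function.ne_iff.1 ha
  have h : ∑ e, a e • T.edgeVec γ c e = chi γ (∑ e, a e • indic c (T.srcSide e)) := by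
    simp only [map_sum, map_smul, edgeVec_eq_chi γ c hT]
  obtain ⟨i, hi⟩ := hc (T.src e)
  obtain ⟨j, hj⟩ := hc (T.tgt e)
  rw [h]
  -- Only the indicator of `e` differs between the two ends of `e`, so the function jumps there by
  -- exactly `a e`.
  refine formB_chi_pos γ (i₀ := i) (j₀ := j) fun hij => he ?_
  simp only [Finset.sum_apply, Pi.smul_apply, smul_eq_mul, indic, hi, hj] at hij
  rw [← sub_eq_zero, ← Finset.sum_sub_distrib, Finset.sum_eq_single e] at hij
  · have h1 := cuts_srcSide hT e
    simpa [h1.1, h1.2.1] using hij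
  · intro e' _ hne
    have h1 := (cuts_srcSide hT e').2.2 e hne.symm
    simp [h1]
  · simp

/-- The vectors of the edges of a tree span all vectors `chi φ` for functions `φ` on the
vertices. -/
lemma chi_mem_span_edgeVec [Fintype E] (hT : T.IsTree) (φ : V → ℝ) :
    chi γ (fun i => φ (c i)) ∈ Submodule.span ℝ (Set.range (T.edgeVec γ c)) := by
  -- The coefficients are the jumps of `φ` along the edges. Subtracting the corresponding indicators
  -- leaves a constant, which `chi` annihilates.
  set a : E → ℝ := fun e => φ (T.src e) - φ (T.tgt e) with ha
  have hconst : ∀ u v, φ u - ∑ e, a e * (if u ∈ T.srcSide e then 1 else 0) =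
      φ v - ∑ e, a e * (if v ∈ T.srcSide e then 1 else 0) := by
    intro u v
    refine Linked.eq_of_forall (f := fun u => φ u - ∑ e, a e * (if u ∈ T.srcSide e then 1 else 0))
      (fun e _ => ?_) (hT.2.1 u v)
    have h : ∑ e', a e' * (if T.src e ∈ T.srcSide e' then (1 : ℝ) else 0) -
        ∑ e', a e' * (if T.tgt e ∈ T.srcSide e' then (1 : ℝ) else 0) = a e := by
      rw [← Finset.sum_sub_distrib, Finset.sum_eq_single e]
      · have h1 := cuts_srcSide hT e
        simp [h1.1, h1.2.1]
      · intro e' _ hne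
        have h1 := (cuts_srcSide hT e').2.2 e hne.symm
        simp [h1]
      · simp
    simp only [ha] at h ⊢
    linarith
  have h : chi γ (fun i => φ (c i)) = ∑ e, a e • T.edgeVec γ c e := by
    have h1 : chi γ ((fun i => φ (c i)) - ∑ e, a e • indic c (T.srcSide e)) = 0 := by
      refine chi_eq_zero γ fun i j => ?_
      have := hconst (c i) (c j)
      simpa [indic] using this
    rw [map_sub, sub_eq_zero] at h1
    rw [h1]
    simp only [map_sum, map_smul, edgeVec_eq_chi γ c hT]
  rw [h]
  exact Submodule.sum_mem _ fun e _ => Submodule.smul_mem _ _ (Submodule.subset_span ⟨e, rfl⟩)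

variable (γ c)

/-- Removing `e` before or after the contraction separates the same labels, so the vectors of `T_J`
form a subfamily of those of `T`. -/
lemma edgeVec_contract (J : Finset E) (e : J) :
    (T.contract J).edgeVec γ (fun i => Quotient.mk (T.contractSetoid J) (c i)) e =
      T.edgeVec γ c e := by
  have h1 : ∀ v, Quotient.mk (T.contractSetoid J) v ∈ (T.contract J).srcSide e ↔
      v ∈ T.srcSide e.1 := fun v => contract_linked_iff J e _ v
  have h2 : ∀ v, Quotient.mk (T.contractSetoid J) v ∈ (T.contract J).tgtSide e ↔
      v ∈ T.tgtSide e.1 := fun v => contract_linked_iff J e _ v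
  simp only [edgeVec, h1, h2]

lemma eContract_eq (J : Finset E) :
    T.eContract γ c J = boostedErr (fun x y => formB γ x y) (fun e : J => T.edgeVec γ c e) 0 := by
  rw [eContract, treeErr, ← biform_eq]
  congr 1
  exact funext fun e => edgeVec_contract γ c J e

/-- The leading behaviour of `Φ^E_T` along the ray of the charges. -/
lemma hasLeading_treeErr [Fintype E] (hT : T.IsTree) (hc : Function.Surjective c) :
    HasLeading (ray γ) 0 (T.treeErr γ c) (T.signSum γ c) := by
  have h := hasLeading_boostedErr (formB_comm γ) (edgeVec_pos (γ := γ) hT hc) (ray γ)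
  simp only [formB_edgeVec_ray] at h
  unfold treeErr signSum
  simp only [eContract_eq]
  rw [biform_eq]
  exact h

end Vectors

end OGraph

/-! ### Trees as simple graphs -/

section TreeOn

variable {V : Type} (o : EdgeOrientation V) (G : TreeOn V)

lemma TreeOn.adj_src_tgt (e : G.1.edgeSet) :
    G.1.Adj ((G.toOGraph o).src e) ((G.toOGraph o).tgt e) := by
  have := e.2
  rw [← o.spec e.1, SimpleGraph.mem_edgeSet] at this
  exact this

lemma TreeOn.linked_of_adj {A : Set G.1.edgeSet} {u v : V} (h : G.1.Adj u v)
    (hA : ⟨s(u, v), h⟩ ∈ A) : (G.toOGraph o).Linked A u v := by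
  have h1 := OGraph.Linked.edge (T := G.toOGraph o) hA
  have h2 := o.spec s(u, v)
  rw [Sym2.eq_iff] at h2
  simp only [TreeOn.toOGraph] at h1
  rcases h2 with ⟨h3, h4⟩ | ⟨h3, h4⟩
  · rwa [h3, h4] at h1
  · rw [h3, h4] at h1
    exact h1.symm

lemma TreeOn.isTree_toOGraph : (G.toOGraph o).IsTree := by
  refine ⟨G.2.1.nonempty, fun u v => ?_, fun e h => ?_⟩
  · obtain ⟨w⟩ := G.2.1.preconnected u v
    induction w with
    | nil => exact OGraph.Linked.refl _ _
    | cons h _ ih => exact (G.linked_of_adj o h (Set.mem_univ _)).trans ih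
  · have hb := SimpleGraph.isAcyclic_iff_forall_isBridge.1 G.2.2 e.2
    rw [← o.spec e.1, SimpleGraph.isBridge_iff] at hb
    have key : ∀ {u v}, (G.toOGraph o).Linked {e}ᶜ u v →
        (G.1.deleteEdges {s(o.src e.1, o.tgt e.1)}).Reachable u v := by
      intro u v h
      induction h with
      | rel _ _ h =>
        obtain ⟨e', he', rfl, rfl⟩ := h
        refine SimpleGraph.Adj.reachable ?_
        rw [SimpleGraph.deleteEdges_adj]
        refine ⟨G.adj_src_tgt o e', fun h => he' (Subtype.ext ?_)⟩
        rw [Set.mem_singleton_iff, o.spec e.1] at h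
        rw [← h]
        exact (o.spec e'.1).symm
      | refl => exact SimpleGraph.Reachable.refl _
      | symm _ _ _ ih => exact ih.symm
      | trans _ _ _ _ _ ih ih' => exact ih.trans ih'
    exact hb (key h)

lemma TreeOn.card_edgeSet [Fintype V] : Fintype.card G.1.edgeSet + 1 = Fintype.card V := by
  rw [← G.2.card_edgeFinset, SimpleGraph.edgeFinset_card]

end TreeOn

/-! ### The large `τ₂` limit -/

section Limit

variable {b n : ℕ} {X : IntersectionData b} (o : ∀ V : Type, EdgeOrientation V)
  (γ : Fin n → Charge X)

lemma HasLeading.diffOp {ξ : Fin n → Fin b → ℝ} {N : ℕ} {f : (Fin n → Fin b → ℝ) → ℝ} {A : ℝ}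
    (hf : HasLeading ξ N f A) (v : Fin n → Fin b → ℝ) :
    HasLeading ξ (N + 1) (diffOp γ v f) (formB γ v ξ * A) := by
  have h := hf.linear_add_deriv (LinearMap.toContinuousLinearMap (formB γ v))
    (1 / (2 * Real.pi)) v
  unfold D4Completion.diffOp
  rw [biform_eq]
  exact h

lemma HasLeading.markOp {B : Finset (Fin n)} {N : ℕ} {f : (Fin n → Fin b → ℝ) → ℝ}
    {A : ℝ} (hf : HasLeading (ray γ) N f A) :
    HasLeading (ray γ) (N + (B.card - 1)) (markOp o γ B f) (markFactor o γ B * A) := by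
  unfold D4Completion.markOp markFactor
  rw [Finset.sum_mul]
  refine HasLeading.sum _ fun G _ => ?_
  rw [mul_assoc]
  refine HasLeading.const_mul ?_ _
  have hcard : B.card - 1 = ∑ _e : G.1.edgeSet, 1 := by
    have h := G.card_edgeSet
    rw [Fintype.card_coe] at h
    rw [Finset.sum_const, smul_eq_mul, mul_one, Finset.card_univ]
    omega
  rw [hcard]
  refine HasLeading.opProd _ (fun _ => 1) _ (fun e N f A hf => ?_) hf
  rw [← formB_vec_ray]
  exact hf.diffOp γ _

lemma blockOf_surjective (P : Finpartition (Finset.univ : Finset (Fin n))) :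
    Function.Surjective (blockOf P) := by
  rintro ⟨B, hB⟩
  obtain ⟨i, hi⟩ := P.nonempty_of_mem_parts hB
  exact ⟨i, Subtype.ext (P.part_eq_of_mem hB hi)⟩

/-- Each edge operator raises the order by one and each block `B` by `|B| - 1`, the number of edges
of a tree on `B`. The total does not depend on the marked tree, so all terms have the same order. -/
lemma card_edges_add_marks {P : Finpartition (Finset.univ : Finset (Fin n))}
    (G : TreeOn (Blocks P)) :
    (0 + ∑ _e : G.1.edgeSet, 1) + ∑ B : Blocks P, (B.1.card - 1) = n - 1 := by
  have h := G.card_edgeSet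
  rw [Fintype.card_coe] at h
  have h1 : ∑ B : Blocks P, (B.1.card - 1) + P.parts.card = n := by
    have h2 := P.sum_card_parts
    rw [Finset.card_univ, Fintype.card_fin] at h2
    refine Eq.trans ?_ h2
    rw [← Finset.sum_coe_sort P.parts, ← Fintype.card_coe P.parts, Fintype.card_eq_sum_ones,
      ← Finset.sum_add_distrib]
    exact Finset.sum_congr rfl fun B _ =>
      Nat.sub_add_cancel (P.nonempty_of_mem_parts B.2).card_pos
  rw [Finset.sum_const, smul_eq_mul, mul_one, Finset.card_univ]
  omega

lemma hasLeading_vertexKernel :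
    HasLeading (ray γ) (n - 1) (vertexKernel o γ) (vertexLimit o γ) := by
  unfold vertexKernel vertexLimit
  refine HasLeading.const_mul (HasLeading.sum _ fun m _ => HasLeading.sum _ fun P _ =>
    HasLeading.sum _ fun G _ => ?_) _
  rw [mul_assoc, ← card_edges_add_marks G]
  refine HasLeading.opProd _ _ _ (fun B N f A hf => hf.markOp o γ) ?_
  refine HasLeading.opProd _ (fun _ => 1) _ (fun e N f A hf => ?_)
    (OGraph.hasLeading_treeErr γ _ (G.isTree_toOGraph _) (blockOf_surjective P))
  rw [← OGraph.formB_endVec_ray]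
  exact hf.diffOp γ _

/-- The limit of the vertex functions. -/
theorem tendsto_vertexFn : Tendsto (vertexFn o γ) atTop (𝓝 (vertexLimit o γ)) := by
  have h : Tendsto (fun τ : ℝ => Real.sqrt (2 * τ)) atTop atTop :=
    Real.tendsto_sqrt_atTop.comp (tendsto_id.const_mul_atTop two_pos)
  -- By definition `point γ τ₂` is `√(2τ₂)` times `ray γ`.
  exact (hasLeading_vertexKernel o γ).2.comp h

end Limit

/-! ### Three trees joined by two edges -/

section Glue

variable {V E : Fin 3 → Type} {T : ∀ r, OGraph (V r) (E r)} {u : ∀ r, V r}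

/-- The map to the vertices of the `r`-th tree which sends the other trees to the chosen vertex. -/
def retract (u : ∀ r, V r) (r : Fin 3) (x : Σ r, V r) : V r :=
  if h : x.1 = r then h ▸ x.2 else u r

@[simp]
lemma retract_mk (r : Fin 3) (v : V r) : retract u r ⟨r, v⟩ = v := by simp [retract]

lemma retract_of_ne {r r' : Fin 3} (h : r' ≠ r) (v : V r') : retract u r ⟨r', v⟩ = u r := by
  simp [retract, h]

@[simp]
lemma retract_base (r r' : Fin 3) : retract u r ⟨r', u r'⟩ = u r := by
  by_cases h : r' = r
  · subst h; simp
  · exact retract_of_ne h _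

variable {i j k l : Fin 3} {A B : Set (Fin 3)}

/-- The retraction collapses the two new edges and all edges of the other trees to the chosen
vertex, so none of them crosses the preimage of a cut. -/
lemma glue_cuts_old (hT : ∀ r, (T r).IsTree) (e : Σ r, E r) :
    (glue T u i j k l).Cuts (Sum.inl e) (retract u e.1 ⁻¹' (T e.1).srcSide e.2) := by
  obtain ⟨r, e⟩ := e
  have h := OGraph.cuts_srcSide (hT r) e
  refine ⟨by simpa [glue] using h.1, by simpa [glue] using h.2.1, ?_⟩
  rintro (⟨r', e'⟩ | s) he
  · by_cases hr : r' = r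
    · subst hr
      have hne : e' ≠ e := fun h => he (by rw [h])
      simpa [glue] using h.2.2 e' hne
    · simp [glue, retract_of_ne hr]
  · cases s <;> simp [glue]

lemma glue_cuts_false (hA : i ∈ A ∧ j ∉ A ∧ (k ∈ A ↔ l ∈ A)) :
    (glue T u i j k l).Cuts (Sum.inr false) {x | x.1 ∈ A} := by
  refine ⟨by simpa [glue] using hA.1, by simpa [glue] using hA.2.1, ?_⟩
  rintro (e | s) he
  · simp [glue]
  · cases s
    · simp at he
    · simpa [glue] using hA.2.2

lemma glue_cuts_true (hB : k ∈ B ∧ l ∉ B ∧ (i ∈ B ↔ j ∈ B)) :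
    (glue T u i j k l).Cuts (Sum.inr true) {x | x.1 ∈ B} := by
  refine ⟨by simpa [glue] using hB.1, by simpa [glue] using hB.2.1, ?_⟩
  rintro (e | s) he
  · simp [glue]
  · cases s
    · simpa [glue] using hB.2.2
    · simp at he

/-- The sets `A` and `B` list the trees on the source sides of the two new edges and show that these
are bridges; `hconn` says that the two edges connect the three trees. -/
lemma glue_isTree (hT : ∀ r, (T r).IsTree) (hA : i ∈ A ∧ j ∉ A ∧ (k ∈ A ↔ l ∈ A))
    (hB : k ∈ B ∧ l ∉ B ∧ (i ∈ B ↔ j ∈ B))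
    (hconn : ∀ R : Setoid (Fin 3), R i j → R k l → ∀ r, R 0 r) :
    (glue T u i j k l).IsTree := by
  refine ⟨⟨⟨0, u 0⟩⟩, ?_, ?_⟩
  · have h1 : ∀ r, (glue T u i j k l).Linked Set.univ ⟨0, u 0⟩ ⟨r, u r⟩ := by
      refine hconn ⟨fun r r' => (glue T u i j k l).Linked Set.univ ⟨r, u r⟩ ⟨r', u r'⟩,
        fun _ => OGraph.Linked.refl _ _, OGraph.Linked.symm, OGraph.Linked.trans⟩ ?_ ?_
      · exact OGraph.Linked.edge (T := glue T u i j k l) (e := Sum.inr false) (Set.mem_univ _)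
      · exact OGraph.Linked.edge (T := glue T u i j k l) (e := Sum.inr true) (Set.mem_univ _)
    have h2 : ∀ x : Σ r, V r, (glue T u i j k l).Linked Set.univ ⟨0, u 0⟩ x := by
      rintro ⟨r, v⟩
      have h3 : (glue T u i j k l).Linked Set.univ (Sigma.mk r (u r)) (Sigma.mk r v) :=
        OGraph.Linked.of_edges (T := T r) (A := Set.univ) (Sigma.mk r) (fun e _ => ?_)
          ((hT r).2.1 (u r) v)
      · exact (h1 r).trans h3
      exact OGraph.Linked.edge (T := glue T u i j k l) (e := Sum.inl ⟨r, e⟩) (Set.mem_univ _)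
    exact fun x y => (h2 x).symm.trans (h2 y)
  · rintro (e | s)
    · exact OGraph.not_linked_of_cuts (glue_cuts_old hT e)
    · cases s
      · exact OGraph.not_linked_of_cuts (glue_cuts_false hA)
      · exact OGraph.not_linked_of_cuts (glue_cuts_true hB)

end Glue

/-- Either one sign is opposite to two equal ones, or one number vanishes and the others have
opposite signs. -/
lemma sign_mul_cyclic {x y z : ℝ} (h : x + y + z = 0) (hx : x ≠ 0) :
    Real.sign y * Real.sign z + Real.sign x * Real.sign y + Real.sign x * Real.sign z = -1 := by
  rcases lt_trichotomy x 0 with h1 | h1 | h1 <;> rcases lt_trichotomy y 0 with h2 | h2 | h2 <;>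
    rcases lt_trichotomy z 0 with h3 | h3 | h3 <;>
    first
    | (exfalso; first | exact hx h1 | linarith)
    | (simp only [h1, h2, h3, Real.sign_of_neg, Real.sign_of_pos, Real.sign_zero]; norm_num)

/-! ### The three-term identity at `x = 0`. -/

section Identity

variable {b n : ℕ} {X : IntersectionData b} {γ : Fin n → Charge X}

lemma chi_indic_compl {V : Type} (c : Fin n → V) (S : Set V) :
    chi γ (OGraph.indic c Sᶜ) = - chi γ (OGraph.indic c S) := by
  rw [eq_neg_iff_add_eq_zero, ← map_add]
  refine chi_eq_zero γ fun i j => ?_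
  simp only [Pi.add_apply, OGraph.indic, Set.mem_compl_iff]
  split_ifs <;> simp_all

lemma chi_indic_ne_zero {V : Type} {c : Fin n → V} (hc : Function.Surjective c) {S : Set V}
    {v w : V} (hv : v ∈ S) (hw : w ∉ S) : chi γ (OGraph.indic c S) ≠ 0 := by
  obtain ⟨i, hi⟩ := hc v
  obtain ⟨j, hj⟩ := hc w
  intro h
  have := formB_chi_pos γ (φ := OGraph.indic c S) (i₀ := i) (j₀ := j)
    (by simp [OGraph.indic, hi, hj, hv, hw])
  simp [h] at this

variable {V E : Fin 3 → Type} {T : ∀ r, OGraph (V r) (E r)}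
  {u : ∀ r, V r} {c : Fin n → Σ r, V r}

/-- The vectors of the edges of a glued tree. -/
lemma edgeVec_glue (hT : ∀ r, (T r).IsTree) {i j k l : Fin 3} {A B : Set (Fin 3)}
    (hA : i ∈ A ∧ j ∉ A ∧ (k ∈ A ↔ l ∈ A)) (hB : k ∈ B ∧ l ∉ B ∧ (i ∈ B ↔ j ∈ B))
    (hconn : ∀ R : Setoid (Fin 3), R i j → R k l → ∀ r, R 0 r) :
    (glue T u i j k l).edgeVec γ c = Sum.elim
      (fun e => chi γ (OGraph.indic c (retract u e.1 ⁻¹' (T e.1).srcSide e.2)))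
      (fun s => if s then chi γ (OGraph.indic c {x | x.1 ∈ B})
        else chi γ (OGraph.indic c {x | x.1 ∈ A})) := by
  have hG := glue_isTree (u := u) hT hA hB hconn
  ext1 e
  rw [OGraph.edgeVec_eq_chi γ c hG]
  rcases e with e | s
  · rw [OGraph.srcSide_eq_of_cuts hG (glue_cuts_old hT e), Sum.elim_inl]
  · cases s
    · rw [OGraph.srcSide_eq_of_cuts hG (glue_cuts_false hA)]; simp
    · rw [OGraph.srcSide_eq_of_cuts hG (glue_cuts_true hB)]; simp

/-- The identity satisfied by the coefficients `Φ^E_T(0)` of three trees which differ by the choice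
of two edges among three. -/
theorem treeErr_hatTree [∀ r, Fintype (E r)] (hT : ∀ r, (T r).IsTree)
    (hc : Function.Surjective c) (r : Fin 3) :
    (hatTree T u 0).treeErr γ c 0 + (hatTree T u 1).treeErr γ c 0 - (hatTree T u 2).treeErr γ c 0 =
      -((hatTree T u r).eContract γ c oldEdges) := by
  have hA0 : (0 : Fin 3) ∈ ({1}ᶜ : Set (Fin 3)) ∧ (1 : Fin 3) ∉ ({1}ᶜ : Set (Fin 3)) ∧
      ((0 : Fin 3) ∈ ({1}ᶜ : Set (Fin 3)) ↔ (2 : Fin 3) ∈ ({1}ᶜ : Set (Fin 3))) := by simp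
  have hB0 : (0 : Fin 3) ∈ ({2}ᶜ : Set (Fin 3)) ∧ (2 : Fin 3) ∉ ({2}ᶜ : Set (Fin 3)) ∧
      ((0 : Fin 3) ∈ ({2}ᶜ : Set (Fin 3)) ↔ (1 : Fin 3) ∈ ({2}ᶜ : Set (Fin 3))) := by simp
  have hA1 : (0 : Fin 3) ∈ ({0} : Set (Fin 3)) ∧ (2 : Fin 3) ∉ ({0} : Set (Fin 3)) ∧
      ((1 : Fin 3) ∈ ({0} : Set (Fin 3)) ↔ (2 : Fin 3) ∈ ({0} : Set (Fin 3))) := by simp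
  have hB1 : (1 : Fin 3) ∈ ({1} : Set (Fin 3)) ∧ (2 : Fin 3) ∉ ({1} : Set (Fin 3)) ∧
      ((0 : Fin 3) ∈ ({1} : Set (Fin 3)) ↔ (2 : Fin 3) ∈ ({1} : Set (Fin 3))) := by simp
  have hA2 : (0 : Fin 3) ∈ ({0} : Set (Fin 3)) ∧ (1 : Fin 3) ∉ ({0} : Set (Fin 3)) ∧
      ((1 : Fin 3) ∈ ({0} : Set (Fin 3)) ↔ (2 : Fin 3) ∈ ({0} : Set (Fin 3))) := by simp
  have hB2 : (1 : Fin 3) ∈ ({2}ᶜ : Set (Fin 3)) ∧ (2 : Fin 3) ∉ ({2}ᶜ : Set (Fin 3)) ∧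
      ((0 : Fin 3) ∈ ({2}ᶜ : Set (Fin 3)) ↔ (1 : Fin 3) ∈ ({2}ᶜ : Set (Fin 3))) := by simp
  have hC0 : ∀ R : Setoid (Fin 3), R 0 1 → R 0 2 → ∀ r, R 0 r := fun R h h' r => by
    fin_cases r
    exacts [R.refl' 0, h, h']
  have hC1 : ∀ R : Setoid (Fin 3), R 0 2 → R 1 2 → ∀ r, R 0 r := fun R h h' r => by
    fin_cases r
    exacts [R.refl' 0, R.trans' h (R.symm' h'), h]
  have hC2 : ∀ R : Setoid (Fin 3), R 0 1 → R 1 2 → ∀ r, R 0 r := fun R h h' r => by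
    fin_cases r
    exacts [R.refl' 0, h, R.trans' h h']
  -- Each added edge cuts off exactly one of the three trees, so its vector is `± w s`, with a minus
  -- sign when the source side is the complement.
  set w : Fin 3 → Fin n → Fin b → ℝ :=
    fun s => chi γ (OGraph.indic c {x | x.1 ∈ ({s} : Set (Fin 3))})
    with hw
  set z : (Σ r, E r) → Fin n → Fin b → ℝ := fun e =>
    chi γ (OGraph.indic c (retract u e.1 ⁻¹' (T e.1).srcSide e.2)) with hz
  have hwc : ∀ s, chi γ (OGraph.indic c {x | x.1 ∈ ({s}ᶜ : Set (Fin 3))}) = - w s := fun s =>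
    chi_indic_compl c {x | x.1 ∈ ({s} : Set (Fin 3))}
  have hv0 : (hatTree T u 0).edgeVec γ c = Sum.elim z fun s => if s then - w 2 else - w 1 := by
    rw [← hwc, ← hwc]
    exact edgeVec_glue hT hA0 hB0 hC0
  have hv1 : (hatTree T u 1).edgeVec γ c = Sum.elim z fun s => if s then w 1 else w 0 :=
    edgeVec_glue hT hA1 hB1 hC1
  have hv2 : (hatTree T u 2).edgeVec γ c = Sum.elim z fun s => if s then - w 2 else w 0 := by
    rw [← hwc]
    exact edgeVec_glue hT hA2 hB2 hC2
  have hT0 : (hatTree T u 0).IsTree := glue_isTree hT hA0 hB0 hC0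
  have hT1 : (hatTree T u 1).IsTree := glue_isTree hT hA1 hB1 hC1
  have hT2 : (hatTree T u 2).IsTree := glue_isTree hT hA2 hB2 hC2
  have hTs : ∀ s, (hatTree T u s).IsTree := fun s => by
    fin_cases s
    exacts [hT0, hT1, hT2]
  have hold : ∀ s e, (hatTree T u s).edgeVec γ c (Sum.inl e) = z e := fun s e => by
    fin_cases s
    · exact congrFun hv0 _
    · exact congrFun hv1 _
    · exact congrFun hv2 _
  have hsum : w 0 + w 1 + w 2 = 0 := by
    simp only [hw, ← map_add]
    refine chi_eq_zero γ fun i j => ?_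
    have h : ∀ i, (OGraph.indic c {x | x.1 ∈ ({0} : Set (Fin 3))} +
        OGraph.indic c {x | x.1 ∈ ({1} : Set (Fin 3))} +
        OGraph.indic c {x | x.1 ∈ ({2} : Set (Fin 3))}) i = (1 : ℝ) := fun i => by
      have h : (c i).1 = 0 ∨ (c i).1 = 1 ∨ (c i).1 = 2 := by omega
      rcases h with h | h | h <;> simp [OGraph.indic, h]
    rw [h, h]
  -- The frame of the first glued tree serves for all of them, since its span contains `chi` of
  -- every function on the vertices.
  obtain ⟨g, hg1, hg2⟩ := exists_orthonormalFrame (formB_comm γ) _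
    (OGraph.edgeVec_pos (γ := γ) hT0 hc)
  have hspan : ∀ φ : (Σ r, V r) → ℝ, chi γ (fun i => φ (c i)) ∈ Submodule.span ℝ (Set.range g) :=
    fun φ => by
      rw [hg2]
      exact OGraph.chi_mem_span_edgeVec hT0 φ
  have hspanS : ∀ S : Set (Σ r, V r), chi γ (OGraph.indic c S) ∈ Submodule.span ℝ (Set.range g) :=
    fun S => hspan fun v => if v ∈ S then 1 else 0
  set y : (((Σ r, E r) ⊕ Bool) → ℝ) → Fin n → Fin b → ℝ := fun a => ∑ k, a k • g k with hy
  set F : (((Σ r, E r) ⊕ Bool) → ℝ) → ℝ := fun a => ∏ e, Real.sign (formB γ (z e) (y a)) with hF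
  have hmeas : ∀ v, Measurable fun a => Real.sign (formB γ v (y a)) := fun v => by
    simp only [hy, map_sum, map_smul, smul_eq_mul]
    exact measurable_sign.comp (by fun_prop)
  have hint : ∀ s, (hatTree T u s).treeErr γ c 0 = ∫ a, ∏ e,
      Real.sign (formB γ ((hatTree T u s).edgeVec γ c e) (y a)) ∂gaussMeasure _ := fun s => by
    rw [OGraph.treeErr, biform_eq, boostedErr_eq_integral (formB_comm γ)
      (exists_orthonormalFrame (formB_comm γ) _ (OGraph.edgeVec_pos (γ := γ) (hTs s) hc)) hg1]
    · simp [hy]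
    · intro e
      rw [OGraph.edgeVec_eq_chi γ c (hTs s)]
      exact hspanS _
  have hcon : (hatTree T u r).eContract γ c oldEdges = ∫ a, F a ∂gaussMeasure _ := by
    rw [OGraph.eContract_eq, boostedErr_eq_integral (formB_comm γ) 
      (exists_orthonormalFrame_subtype (formB_comm γ)
        (OGraph.edgeVec_pos (γ := γ) (hTs r) hc) oldEdges) hg1]
    · congr 1
      ext a
      simp only [map_zero, zero_add]
      rw [Finset.prod_coe_sort oldEdges fun e =>
        Real.sign (formB γ ((hatTree T u r).edgeVec γ c e) (y a))]
      simp [oldEdges, Finset.prod_filter, Fintype.prod_sum_type, hold, hF]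
    · intro e
      rw [OGraph.edgeVec_eq_chi γ c (hTs r)]
      exact hspanS _
  have hI : ∀ v v', Integrable (fun a => F a * (Real.sign (formB γ v (y a)) *
      Real.sign (formB γ v' (y a)))) (gaussMeasure ((Σ r, E r) ⊕ Bool)) := fun v v' => by
    refine Integrable.of_bound (C := 1) ?_ (Eventually.of_forall fun a => ?_)
    · exact ((Finset.measurable_prod _ fun e _ => hmeas _).mul
        ((hmeas v).mul (hmeas v'))).aestronglyMeasurable
    · rw [norm_mul, norm_mul]
      exact mul_le_one₀ (abs_prod_sign_le_one _ _) (by positivity)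
        (mul_le_one₀ (abs_sign_le_one _) (norm_nonneg _) (abs_sign_le_one _))
  rw [hint, hint, hint, hcon, hv0, hv1, hv2]
  simp only [Fintype.prod_sum_type, Fintype.prod_bool, Sum.elim_inl, Sum.elim_inr, if_true,
    Bool.false_eq_true, if_false]
  rw [← integral_add (hI _ _) (hI _ _), ← integral_sub ((hI _ _).fun_add (hI _ _)) (hI _ _),
    ← integral_neg]
  refine integral_congr_ae ?_
  have hw0 : w 0 ≠ 0 := chi_indic_ne_zero hc (v := ⟨0, u 0⟩) (w := ⟨1, u 1⟩) (by simp) (by simp)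
  filter_upwards [ae_form_ne_zero hg1 (hspanS _) hw0] with a ha
  have h1 : formB γ (w 0) (y a) + formB γ (w 1) (y a) + formB γ (w 2) (y a) = 0 := by
    rw [← LinearMap.add_apply, ← map_add, ← LinearMap.add_apply, ← map_add, hsum]
    simp
  have h2 := sign_mul_cyclic h1 ha
  simp only [map_neg, LinearMap.neg_apply, Real.sign_neg]
  change F a * _ + F a * _ - F a * _ = - F a
  linear_combination F a * h2

end Identity

/-! ### Trees with one and three vertices -/

section SmallTrees

variable {V : Type} (o : EdgeOrientation V)

lemma aCoef_of_unique {E : Type} [Fintype V] [Fintype E] [Unique V] [IsEmpty E] (T : OGraph V E) :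
    T.aCoef = 1 := by
  rw [OGraph.aCoef, OGraph.aSub]
  have h : ∀ v : V, Finset.univ.erase v = ∅ := fun v => by
    ext w
    simp [Subsingleton.elim w v]
  have hp : ∀ v : {v // v ∈ (Finset.univ : Finset V)}, (-1 : ℚ) ^ T.inDeg Finset.univ v.1 *
      ∏ C : {C // C ∈ T.comps (Finset.univ.erase v.1)}, T.aSub C.1 = 1 := fun v => by
    have : IsEmpty {C // C ∈ T.comps (Finset.univ.erase v.1)} := by
      rw [h]
      exact ⟨fun C => by simpa [OGraph.comps] using C.2⟩
    rw [Finset.prod_of_isEmpty]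
    simp [OGraph.inDeg]
  simp only [hp]
  simp

/-- A tree on three vertices is a star. -/
lemma exists_eq_starGraph {c : Fin 3 → V}
    (hc : Function.Bijective c) (G : TreeOn V) :
    ∃ j, G = ⟨SimpleGraph.starGraph (c j), SimpleGraph.isTree_starGraph _⟩ := by
  have : Nontrivial V := ⟨c 0, c 1, fun h => by simpa using hc.1 h⟩
  have hadj : ∀ i, ∃ k, G.1.Adj (c i) (c k) := fun i => by
    obtain ⟨w, hw⟩ := G.2.1.preconnected.exists_adj_of_nontrivial (c i)
    obtain ⟨k, rfl⟩ := hc.2 w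
    exact ⟨k, hw⟩
  -- Each vertex has a neighbour; in each of the eight cases some vertex is adjacent to both others.
  have key : ∃ j, ∀ i, i ≠ j → G.1.Adj (c j) (c i) := by
    have hne : ∀ {i k}, G.1.Adj (c i) (c k) → i ≠ k := fun h hik => h.ne (by rw [hik])
    obtain ⟨k0, h0⟩ := hadj 0
    obtain ⟨k1, h1⟩ := hadj 1
    obtain ⟨k2, h2⟩ := hadj 2
    have n0 := hne h0
    have n1 := hne h1
    have n2 := hne h2
    fin_cases k0 <;> fin_cases k1 <;> fin_cases k2 <;> simp at n0 n1 n2 <;>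
    first
    | (refine ⟨0, fun i hi => ?_⟩
       fin_cases i <;>
       first
       | exact absurd rfl hi
       | assumption
       | exact SimpleGraph.Adj.symm (by assumption))
    | (refine ⟨1, fun i hi => ?_⟩
       fin_cases i <;>
       first
       | exact absurd rfl hi
       | assumption
       | exact SimpleGraph.Adj.symm (by assumption))
    | (refine ⟨2, fun i hi => ?_⟩
       fin_cases i <;>
       first
       | exact absurd rfl hi
       | assumption
       | exact SimpleGraph.Adj.symm (by assumption))
  obtain ⟨j, hj⟩ := key
  refine ⟨j, Subtype.ext ?_⟩
  -- A tree is a minimal connected graph, so containing the star forces equality.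
  refine le_antisymm ((SimpleGraph.isTree_iff_minimal_connected.1 G.2).2
    (SimpleGraph.connected_starGraph _) ?_) ?_
  all_goals
    intro u v huv
    rw [SimpleGraph.starGraph_adj] at huv
    obtain ⟨i, rfl⟩ := hc.2 u
    obtain ⟨k, rfl⟩ := hc.2 v
    rcases huv with ⟨hne, h | h⟩
    · obtain rfl := hc.1 h
      exact hj k fun h => hne (by rw [h])
    · obtain rfl := hc.1 h
      exact (hj i fun h => hne (by rw [h])).symm

variable {b n : ℕ} {X : IntersectionData b} (γ : Fin n → Charge X) {c : Fin n → V}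

/-- The contribution of the edge at a leaf, which does not depend on its orientation. -/
lemma leaf_factor (hc : Function.Bijective c) (G : TreeOn V) {i j : Fin n}
    (hij : G.1.Adj (c i) (c j)) (hleaf : ∀ v, G.1.Adj (c i) v → v = c j)
    (y : Fin n → Fin b → ℝ) :
    (G.toOGraph o).endDirac γ c ⟨s(c i, c j), hij⟩ *
        Real.sign (formB γ ((G.toOGraph o).edgeVec γ c ⟨s(c i, c j), hij⟩) y) =
      dirac γ i j * Real.sign (formB γ (chi γ (OGraph.indic c {c i})) y) := by
  have hT := G.isTree_toOGraph o
  set e : G.1.edgeSet := ⟨s(c i, c j), hij⟩ with he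
  have hne : c i ≠ c j := hij.ne
  have hfil : ∀ k, Finset.univ.filter (fun l => c l = c k) = {k} := fun k => by
    ext l
    simp [hc.1.eq_iff]
  have hother : ∀ e', e' ≠ e → (G.toOGraph o).src e' ≠ c i ∧ (G.toOGraph o).tgt e' ≠ c i := by
    intro e' hne'
    have hadj := G.adj_src_tgt o e'
    have hspec : s((G.toOGraph o).src e', (G.toOGraph o).tgt e') = e'.1 := o.spec e'.1
    refine ⟨fun h => hne' (Subtype.ext ?_), fun h => hne' (Subtype.ext ?_)⟩
    · rw [h] at hadj
      rw [← hspec, h, hleaf _ hadj]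
    · rw [h] at hadj
      rw [← hspec, h, hleaf _ hadj.symm, Sym2.eq_swap]
  have hspec := o.spec e.1
  rw [he, Sym2.eq_iff] at hspec
  rw [OGraph.edgeVec_eq_chi γ c hT]
  rcases hspec with ⟨hs, ht⟩ | ⟨hs, ht⟩
  · have hs' : (G.toOGraph o).src e = c i := hs
    have ht' : (G.toOGraph o).tgt e = c j := ht
    have hcut : (G.toOGraph o).Cuts e {c i} := by
      refine ⟨hs', by rw [ht']; exact hne.symm, fun e' he' => ?_⟩
      simp [hother e' he']
    rw [OGraph.srcSide_eq_of_cuts hT hcut]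
    simp [OGraph.endDirac, hs', ht', hfil]
  -- For an edge pointing at the leaf both the Dirac product and the edge vector change sign.
  · have hs' : (G.toOGraph o).src e = c j := hs
    have ht' : (G.toOGraph o).tgt e = c i := ht
    have hcut : (G.toOGraph o).Cuts e {c i}ᶜ := by
      refine ⟨by rw [hs']; exact hne.symm, by rw [ht']; simp, fun e' he' => ?_⟩
      simp [hother e' he']
    rw [OGraph.srcSide_eq_of_cuts hT hcut, chi_indic_compl]
    have hanti : dirac γ j i = - dirac γ i j := by
      simp only [dirac, ← Finset.sum_neg_distrib, neg_sub]
    simp [OGraph.endDirac, hs', ht', hfil, hanti, Real.sign_neg]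

/-- The contribution of the star with centre `j` and leaves `i`, `k`. -/
lemma star_factor {c : Fin n → V} (hc : Function.Bijective c) {i j k : Fin n} (hij : i ≠ j)
    (hkj : k ≠ j) (hik : i ≠ k) (hall : ∀ l, l = i ∨ l = j ∨ l = k) (y : Fin n → Fin b → ℝ)
    (G : TreeOn V) (hG : G = ⟨SimpleGraph.starGraph (c j), SimpleGraph.isTree_starGraph _⟩)
    [Fintype G.1.edgeSet] :
    (∏ e, ((G.toOGraph o).endDirac γ c e *
        Real.sign (formB γ ((G.toOGraph o).edgeVec γ c e) y))) =
      (dirac γ i j * Real.sign (formB γ (chi γ (OGraph.indic c {c i})) y)) *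
        (dirac γ k j * Real.sign (formB γ (chi γ (OGraph.indic c {c k})) y)) := by
  have hadj : ∀ u v, G.1.Adj u v ↔ u ≠ v ∧ (u = c j ∨ v = c j) := by
    subst hG
    exact fun u v => SimpleGraph.starGraph_adj
  have hi : G.1.Adj (c i) (c j) := (hadj _ _).2 ⟨hc.1.ne hij, Or.inr rfl⟩
  have hk : G.1.Adj (c k) (c j) := (hadj _ _).2 ⟨hc.1.ne hkj, Or.inr rfl⟩
  have hli : ∀ v, G.1.Adj (c i) v → v = c j := fun v hv =>
    ((hadj _ _).1 hv).2.resolve_left (hc.1.ne hij)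
  have hlk : ∀ v, G.1.Adj (c k) v → v = c j := fun v hv =>
    ((hadj _ _).1 hv).2.resolve_left (hc.1.ne hkj)
  rw [← leaf_factor o γ hc G hi hli, ← leaf_factor o γ hc G hk hlk]
  have hne : (⟨s(c i, c j), hi⟩ : G.1.edgeSet) ≠ ⟨s(c k, c j), hk⟩ := by
    intro h
    have h1 := congrArg Subtype.val h
    simp [hc.1.eq_iff, hik, hij] at h1
  have huniv : (Finset.univ : Finset G.1.edgeSet) = {⟨s(c i, c j), hi⟩, ⟨s(c k, c j), hk⟩} := by
    ext ⟨e, he⟩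
    simp only [Finset.mem_univ, Finset.mem_insert, Finset.mem_singleton, true_iff]
    induction e with
    | h u v =>
      have h1 : G.1.Adj u v := he
      obtain ⟨p, rfl⟩ := hc.2 u
      obtain ⟨q, rfl⟩ := hc.2 v
      rw [hadj, hc.1.eq_iff, hc.1.eq_iff, Ne, hc.1.eq_iff] at h1
      rcases h1 with ⟨h2, rfl | rfl⟩
      · rcases hall q with rfl | rfl | rfl
        · exact Or.inl (Subtype.ext Sym2.eq_swap)
        · exact absurd rfl h2
        · exact Or.inr (Subtype.ext Sym2.eq_swap)
      · rcases hall p with rfl | rfl | rfl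
        · exact Or.inl rfl
        · exact absurd rfl h2
        · exact Or.inr rfl
  rw [huniv, Finset.prod_pair hne]

end SmallTrees

/-! ### Charges for which all `Γ_e` vanish -/

section Degenerate

variable {V E : Type} [Fintype E] {T : OGraph V E} {b n : ℕ} {X : IntersectionData b}
  {γ : Fin n → Charge X} {c : Fin n → V}

lemma signSum_of_isEmpty [IsEmpty E] : T.signSum γ c = T.signProd γ c := by
  have h : T.eContract γ c ∅ = 1 := by
    have hf : ∃ f : (∅ : Finset E) → Fin n → Fin b → ℝ, IsOrthonormalFrame
        (fun x y => formB γ x y) (fun e : (∅ : Finset E) => T.edgeVec γ c e) f :=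
      exists_orthonormalFrame (formB_comm γ) _ fun a ha => absurd (Subsingleton.elim a 0) ha
    rw [OGraph.eContract_eq, boostedErr_eq_integral (formB_comm γ) hf hf.choose_spec.1
      fun e => isEmptyElim e.1]
    simp
  rw [OGraph.signSum, Fintype.sum_subsingleton _ ∅, h, Finset.prod_empty, mul_one, one_mul,
    Finset.compl_empty, OGraph.signProd]

lemma signSum_of_edgeDirac_eq_zero (h : ∀ e, T.edgeDirac γ c e = 0) :
    T.signSum γ c = T.eContract γ c Finset.univ := by
  rw [OGraph.signSum, Finset.sum_eq_single Finset.univ]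
  · simp [h]
  · intro J _ hJ
    obtain ⟨e, he⟩ : ∃ e, e ∉ J := by simpa [Finset.eq_univ_iff_forall] using hJ
    rw [mul_eq_zero]
    right
    exact Finset.prod_eq_zero (Finset.mem_compl.2 he) (by simp [h])
  · simp

/-- The frame `g` is independent of the tree, so contributions of different trees can be added under
one integral. -/
lemma kappa_mul_signSum_eq_integral {K : Type} [Fintype K] (hT : T.IsTree)
    (hc : Function.Surjective c) (h : ∀ e, T.edgeDirac γ c e = 0) {g : K → Fin n → Fin b → ℝ}
    (hg : ∀ i j, formB γ (g i) (g j) = if i = j then 1 else 0)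
    (hspan : ∀ φ : V → ℝ, chi γ (fun i => φ (c i)) ∈ Submodule.span ℝ (Set.range g)) :
    T.kappa γ c * T.signSum γ c = ∫ a, ∏ e, (T.endDirac γ c e *
      Real.sign (formB γ (T.edgeVec γ c e) (∑ k, a k • g k))) ∂gaussMeasure K := by
  rw [signSum_of_edgeDirac_eq_zero h, OGraph.eContract_eq, boostedErr_eq_integral (formB_comm γ)
    (exists_orthonormalFrame_subtype (formB_comm γ) (OGraph.edgeVec_pos (γ := γ) hT hc) _) hg,
    OGraph.kappa, ← integral_const_mul]
  · congr 1
    ext a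
    rw [Finset.prod_mul_distrib]
    simp only [map_zero, zero_add]
    rw [Finset.prod_coe_sort Finset.univ fun e =>
      Real.sign (formB γ (T.edgeVec γ c e) (∑ k, a k • g k))]
  · intro e
    rw [OGraph.edgeVec_eq_chi γ c hT]
    exact hspan fun v => if v ∈ T.srcSide e then 1 else 0

end Degenerate

/-! ### Three charges with cyclic Dirac products. -/

section ThreeCharges

variable {V : Type} [Fintype V] (o : EdgeOrientation V) {b : ℕ} {X : IntersectionData b}
  {γ : Fin 3 → Charge X} {c : Fin 3 → V}

/-- The star with centre `c j`. -/
def starTree (c : Fin 3 → V) (j : Fin 3) : TreeOn V :=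
  ⟨SimpleGraph.starGraph (c j), SimpleGraph.isTree_starGraph _⟩

omit [Fintype V] in
lemma starTree_bijective (hc : Function.Bijective c) : Function.Bijective (starTree c) := by
  refine ⟨fun j j' h => ?_, fun G => ?_⟩
  · by_contra hne
    obtain ⟨l, hl, hl'⟩ := (by decide : ∀ j j' : Fin 3, ∃ l, l ≠ j ∧ l ≠ j') j j'
    have h1 : (SimpleGraph.starGraph (c j)).Adj (c j) (c l) :=
      SimpleGraph.starGraph_center_adj (hc.1.ne hl.symm)
    have h2 : SimpleGraph.starGraph (c j) = SimpleGraph.starGraph (c j') := congrArg Subtype.val h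
    rw [h2, SimpleGraph.starGraph_adj] at h1
    rcases h1.2 with h3 | h3
    · exact hne (hc.1 h3)
    · exact hl' (hc.1 h3)
  · obtain ⟨j, hj⟩ := exists_eq_starGraph hc G
    exact ⟨j, hj.symm⟩

/-- For three charges with cyclic Dirac products all equal to one, the sum of `κ_T 𝖲_T` over all
trees is one. -/
lemma sum_kappa_mul_signSum (hc : Function.Bijective c)
    (hzero : ∀ φ, formB γ (chi γ φ) (ray γ) = 0)
    (h01 : dirac γ 0 1 = 1) (h12 : dirac γ 1 2 = 1) (h20 : dirac γ 2 0 = 1) :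
    ∑ G : TreeOn V, (G.toOGraph o).kappa γ c * (G.toOGraph o).signSum γ c = 1 := by
  have hanti : ∀ i j, dirac γ j i = - dirac γ i j := fun i j => by
    simp only [dirac, ← Finset.sum_neg_distrib, neg_sub]
  obtain ⟨g, hg1, hg2⟩ := exists_orthonormalFrame (formB_comm γ) _
    (OGraph.edgeVec_pos (γ := γ) ((starTree c 0).isTree_toOGraph o) hc.2)
  have hspan : ∀ φ : V → ℝ, chi γ (fun i => φ (c i)) ∈ Submodule.span ℝ (Set.range g) :=
    fun φ => by
      rw [hg2]
      exact OGraph.chi_mem_span_edgeVec ((starTree c 0).isTree_toOGraph o) φ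
  have hterm := fun G : TreeOn V => kappa_mul_signSum_eq_integral (G.isTree_toOGraph o) hc.2
    (fun e => by
      rw [← OGraph.formB_edgeVec_ray, OGraph.edgeVec_eq_chi γ c (G.isTree_toOGraph o), hzero])
    hg1 hspan
  simp only [hterm]
  rw [← (starTree_bijective hc).sum_comp, Fin.sum_univ_three]
  set w : Fin 3 → Fin 3 → Fin b → ℝ := fun i => chi γ (OGraph.indic c {c i}) with hw
  simp only [fun a => star_factor o γ hc (i := 1) (j := 0) (k := 2) (by decide) (by decide)
      (by decide) (by decide) a (starTree c 0) rfl,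
    fun a => star_factor o γ hc (i := 0) (j := 1) (k := 2) (by decide) (by decide)
      (by decide) (by decide) a (starTree c 1) rfl,
    fun a => star_factor o γ hc (i := 0) (j := 2) (k := 1) (by decide) (by decide)
      (by decide) (by decide) a (starTree c 2) rfl,
    hanti 0 1, hanti 1 2, hanti 2 0, h01, h12, h20]
  have hmeas : ∀ v, Measurable fun a : _ → ℝ => Real.sign (formB γ v (∑ k, a k • g k)) :=
    fun v => by
      simp only [map_sum, map_smul, smul_eq_mul]
      exact measurable_sign.comp (by fun_prop)
  have hI : ∀ (s t : ℝ) v v', Integrable (fun a => s * Real.sign (formB γ v (∑ k, a k • g k)) *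
      (t * Real.sign (formB γ v' (∑ k, a k • g k)))) (gaussMeasure (starTree c 0).1.edgeSet) := by
    intro s t v v'
    refine Integrable.of_bound (C := |s| * |t|) ?_ (Eventually.of_forall fun a => ?_)
    · exact (((hmeas v).const_mul s).mul ((hmeas v').const_mul t)).aestronglyMeasurable
    · simp only [norm_mul, Real.norm_eq_abs]
      gcongr
      · exact mul_le_of_le_one_right (abs_nonneg _) (abs_sign_le_one _)
      · exact mul_le_of_le_one_right (abs_nonneg _) (abs_sign_le_one _)
  rw [← integral_add (hI _ _ _ _) (hI _ _ _ _),
    ← integral_add ((hI _ _ _ _).fun_add (hI _ _ _ _)) (hI _ _ _ _)]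
  have hsum : w 0 + w 1 + w 2 = 0 := by
    simp only [hw, ← map_add]
    refine chi_eq_zero γ fun i j => ?_
    have h : ∀ i, (OGraph.indic c {c 0} + OGraph.indic c {c 1} + OGraph.indic c {c 2}) i =
        (1 : ℝ) := fun i => by
      fin_cases i <;> simp [OGraph.indic, hc.1.eq_iff]
    rw [h, h]
  have hw0 : w 0 ≠ 0 := chi_indic_ne_zero hc.2 (v := c 0) (w := c 1) rfl
    (by simp [hc.1.eq_iff])
  -- At each centre one leaf contributes Dirac product `1` and the other `-1`, so the integrand is
  -- minus the cyclic sum of products of signs.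
  have hone : ∀ᵐ a ∂gaussMeasure (starTree c 0).1.edgeSet,
      -1 * Real.sign (formB γ (w 1) (∑ k, a k • g k)) *
          (1 * Real.sign (formB γ (w 2) (∑ k, a k • g k))) +
        1 * Real.sign (formB γ (w 0) (∑ k, a k • g k)) *
          (-1 * Real.sign (formB γ (w 2) (∑ k, a k • g k))) +
        -1 * Real.sign (formB γ (w 0) (∑ k, a k • g k)) *
          (1 * Real.sign (formB γ (w 1) (∑ k, a k • g k))) = 1 := by
    filter_upwards [ae_form_ne_zero hg1 (hspan fun v => if v ∈ ({c 0} : Set V) then 1 else 0) hw0]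
      with a ha
    have h1 : formB γ (w 0) (∑ k, a k • g k) + formB γ (w 1) (∑ k, a k • g k) +
        formB γ (w 2) (∑ k, a k • g k) = 0 := by
      rw [← LinearMap.add_apply, ← map_add, ← LinearMap.add_apply, ← map_add, hsum]
      simp
    linear_combination -(sign_mul_cyclic h1 ha)
  rw [integral_congr_ae hone]
  simp

end ThreeCharges

/-! ### An explicit example -/

section Example

/-- The intersection numbers with `p³ = 3 (p¹)² p²`. -/
def exKappa (i j k : Fin 2) : ℤ := if i.val + j.val + k.val = 1 then 1 else 0

lemma cubic_exKappa (p q r : Fin 2 → ℤ) :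
    cubic exKappa p q r = p 0 * q 0 * r 1 + p 0 * q 1 * r 0 + p 1 * q 0 * r 0 := by
  simp [cubic, exKappa, Fin.sum_univ_two]

lemma tri_exKappa (x y z : Fin 2 → ℝ) :
    tri exKappa x y z = x 0 * y 0 * z 1 + x 0 * y 1 * z 0 + x 1 * y 0 * z 0 := by
  simp [tri_apply, exKappa, Fin.sum_univ_two]

/-- The classes with positive components. -/
def exDiv : Set (Fin 2 → ℤ) := {p | 0 < p 0 ∧ 0 < p 1}

/-- The generators of the dual cone. -/
def exCurve : Set (Fin 2 → ℤ) := {![1, 0], ![0, 1]}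

lemma inChargeCone_example (p : Fin 2 → ℤ) : InChargeCone exKappa exDiv exCurve p ↔ p ∈ exDiv := by
  constructor
  · rintro ⟨-, -, h⟩
    have h0 := h ![1, 0] (by simp [exCurve])
    have h1 := h ![0, 1] (by simp [exCurve])
    simp only [Fin.sum_univ_two, Matrix.cons_val_zero, Matrix.cons_val_one] at h0 h1
    exact ⟨by linarith, by linarith⟩
  · rintro ⟨h0, h1⟩
    refine ⟨?_, ?_, ?_⟩
    · rw [cubic_exKappa]
      positivity
    · rintro r ⟨hr0, hr1⟩
      rw [cubic_exKappa]
      positivity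
    · rintro k (rfl | rfl) <;> simpa [Fin.sum_univ_two]

lemma signature_example {p : Fin 2 → ℤ} (hp : p ∈ exDiv) :
    sigPos (kappaMat exKappa p).toQuadraticForm' = 1 ∧
      sigNeg (kappaMat exKappa p).toQuadraticForm' = 1 := by
  have h0 : (0 : ℝ) < p 0 := by exact_mod_cast hp.1
  have h1 : (0 : ℝ) < p 1 := by exact_mod_cast hp.2
  have hq : ∀ x, (kappaMat exKappa p).toQuadraticForm' x = x 0 ^ 2 * p 1 + 2 * x 0 * x 1 * p 0 :=
    fun x => by rw [quadForm_kappaMat, tri_exKappa]; simp only [rvec]; ring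
  have hadd := QuadraticForm.sigPos_add_sigNeg_add_radical
    (Q := (kappaMat exKappa p).toQuadraticForm')
  rw [Module.finrank_fin_fun] at hadd
  have key : ∀ (Q : QuadraticForm ℝ (Fin 2 → ℝ)) (x : Fin 2 → ℝ), 0 < Q x → 1 ≤ sigPos Q := by
    intro Q x hx
    have hx0 : x ≠ 0 := by
      rintro rfl
      simp at hx
    rw [← finrank_span_singleton (K := ℝ) hx0]
    refine le_sigPos_of_posDef _ ?_
    rintro ⟨y, hy⟩ hy0
    obtain ⟨t, rfl⟩ := Submodule.mem_span_singleton.1 hy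
    have ht : t ≠ 0 := by
      rintro rfl
      simp at hy0
    rw [QuadraticMap.restrict_apply, QuadraticMap.map_smul, smul_eq_mul]
    exact mul_pos (mul_self_pos.2 ht) hx
  have hpos := key (kappaMat exKappa p).toQuadraticForm' ![1, 0] (by rw [hq]; simpa using h1)
  -- The form takes the value `-(p 0)² p 1` at this vector, and `p 1` at `![1, 0]`. One direction of
  -- each sign exhausts the dimension two.
  have hneg := key (-(kappaMat exKappa p).toQuadraticForm') ![p 0, -p 1] (by
    rw [neg_apply, hq]
    simp only [Matrix.cons_val_zero, Matrix.cons_val_one]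
    have : 0 < (p 0 : ℝ) ^ 2 * p 1 := by positivity
    linarith)
  rw [sigPos_neg] at hneg
  omega

/-- An intersection form with two classes. -/
def exData : IntersectionData 2 where
  κ := exKappa
  κ_swap_left i j k := by simp only [exKappa, add_comm i.val]
  κ_swap_right i j k := by simp only [exKappa, add_assoc, add_comm j.val]
  effDiv := exDiv
  effCurve := exCurve
  cone_add p p' := by
    simp only [inChargeCone_example]
    exact fun h h' => ⟨add_pos h.1 h'.1, add_pos h.2 h'.2⟩
  cone_effective p := (inChargeCone_example p).1
  signature_pos p hp := (signature_example ((inChargeCone_example p).1 hp)).1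
  signature_neg p hp := by rw [(signature_example ((inChargeCone_example p).1 hp)).2]

/-- The D4-brane charges of the example. -/
def exP : Fin 3 → Fin 2 → ℤ := ![![2, 1], ![2, 2], ![4, 1]]

/-- The D2-brane charges of the example. -/
def exQ : Fin 3 → Fin 2 → ℝ := ![![0, -1], ![2, -7], ![0, 0]]

/-- Three charges with `γ₁₂ = γ₂₃ = γ₃₁ = 1`. -/
def exCharge (i : Fin 3) : Charge exData where
  p := exP i
  q := exQ i
  p_mem := by
    refine (inChargeCone_example _).2 ⟨?_, ?_⟩ <;> fin_cases i <;> simp [exP]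
  q_mem a := by
    -- These are the components of `q - (p⁰ p¹, (p⁰)² / 2)`.
    refine ⟨![![-2, -3], ![-2, -9], ![-4, -8]] i a, ?_⟩
    fin_cases i <;> fin_cases a <;>
      simp [exData, exP, exQ, kappaMat, exKappa, Fin.sum_univ_two] <;> norm_num

lemma dirac_exCharge (i j : Fin 3) : dirac exCharge i j =
    exP j 0 * exQ i 0 - exP i 0 * exQ j 0 + (exP j 1 * exQ i 1 - exP i 1 * exQ j 1) := by
  simp only [dirac, exCharge, Fin.sum_univ_two]

/-- The pairing equals `∑_i φ_i ∑_j γ_{ij}`, and each inner sum is `1 - 1`. Hence `Γ_e = 0` for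
every edge of every tree. -/
lemma formB_chi_ray_example (φ : Fin 3 → ℝ) :
    formB exCharge (chi exCharge φ) (ray exCharge) = 0 := by
  rw [formB_ray]
  simp [chi, rvec, exCharge, exP, exQ, Fin.sum_univ_three, Fin.sum_univ_two]
  ring

variable (o : ∀ V : Type, EdgeOrientation V)

lemma markFactor_of_card_eq_one {b n : ℕ} {X : IntersectionData b} (γ : Fin n → Charge X)
    {B : Finset (Fin n)} (hB : B.card = 1) : markFactor o γ B = 1 := by
  obtain ⟨i, rfl⟩ := Finset.card_eq_one.1 hB
  let hu : Unique {j // j ∈ ({i} : Finset (Fin n))} :=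
    { default := ⟨i, Finset.mem_singleton_self i⟩
      uniq := fun j => Subtype.ext (Finset.mem_singleton.1 j.2) }
  have hadj : ∀ G : TreeOn {j // j ∈ ({i} : Finset (Fin n))}, IsEmpty G.1.edgeSet := fun G =>
    ⟨fun e => (G.adj_src_tgt (o _) e).ne (Subsingleton.elim _ _)⟩
  have hs : Subsingleton (TreeOn {j // j ∈ ({i} : Finset (Fin n))}) :=
    ⟨fun G G' => Subtype.ext (Subsingleton.elim _ _)⟩
  obtain ⟨G⟩ : Nonempty (TreeOn {j // j ∈ ({i} : Finset (Fin n))}) :=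
    ⟨⟨SimpleGraph.starGraph default, SimpleGraph.isTree_starGraph _⟩⟩
  have := hadj G
  rw [markFactor, Fintype.sum_subsingleton _ G, aCoef_of_unique, Finset.prod_of_isEmpty]
  simp

end Example

/-! ### Failure of the formula with products of signs. -/

section Naive

variable (o : ∀ V : Type, EdgeOrientation V)

lemma signProd_exCharge {V : Type} [Fintype V] (o : EdgeOrientation V) (G : TreeOn V)
    (c : Fin 3 → V) (hV : Fintype.card V = 3) : (G.toOGraph o).signProd exCharge c = 0 := by
  have hcard := G.card_edgeSet
  obtain ⟨e⟩ : Nonempty G.1.edgeSet := Fintype.card_pos_iff.1 (by omega)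
  refine Finset.prod_eq_zero (Finset.mem_univ e) ?_
  rw [← OGraph.formB_edgeVec_ray, OGraph.edgeVec_eq_chi _ c (G.isTree_toOGraph o),
    formB_chi_ray_example, Real.sign_zero]

lemma blockOf_bijective_of_card {n : ℕ} {P : Finpartition (Finset.univ : Finset (Fin n))}
    (hP : P.parts.card = n) : Function.Bijective (blockOf P) :=
  (Fintype.bijective_iff_surjective_and_card _).2
    ⟨blockOf_surjective P, by rw [Fintype.card_fin, Fintype.card_coe, hP]⟩

lemma card_block_eq_one {n : ℕ} {P : Finpartition (Finset.univ : Finset (Fin n))}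
    (hP : P.parts.card = n) (B : Blocks P) : B.1.card = 1 := by
  obtain ⟨i, rfl⟩ := blockOf_surjective P B
  refine Finset.card_eq_one.2 ⟨i, Finset.eq_singleton_iff_unique_mem.2
    ⟨P.mem_part (Finset.mem_univ i), fun j hj => ?_⟩⟩
  refine (blockOf_bijective_of_card hP).1 (Subtype.ext ?_)
  exact P.part_eq_of_mem (P.part_mem.2 (Finset.mem_univ i)) hj

/-- The term of the partition `P` in the limit of the vertex function. -/
def limitTerm {n b : ℕ} {X : IntersectionData b} (γ : Fin n → Charge X)
    (P : Finpartition (Finset.univ : Finset (Fin n))) : ℝ :=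
  ∑ G : TreeOn (Blocks P), (∏ B : Blocks P, markFactor o γ B.1) *
    (G.toOGraph (o _)).kappa γ (blockOf P) * (G.toOGraph (o _)).signSum γ (blockOf P)

/-- The term of the partition `P` in the expression with products of signs. -/
def naiveTerm {n b : ℕ} {X : IntersectionData b} (γ : Fin n → Charge X)
    (P : Finpartition (Finset.univ : Finset (Fin n))) : ℝ :=
  ∑ G : TreeOn (Blocks P), (∏ B : Blocks P, markFactor o γ B.1) *
    (G.toOGraph (o _)).kappa γ (blockOf P) * (G.toOGraph (o _)).signProd γ (blockOf P)

lemma dirac_exCharge_cyclic : dirac exCharge 0 1 = 1 ∧ dirac exCharge 1 2 = 1 ∧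
    dirac exCharge 2 0 = 1 := by
  simp only [dirac_exCharge]
  refine ⟨?_, ?_, ?_⟩ <;> simp [exP, exQ] <;> norm_num

lemma limitTerm_of_card_parts {P : Finpartition (Finset.univ : Finset (Fin 3))}
    (hP : P.parts.card = 3) : limitTerm o exCharge P = 1 := by
  have hB : ∏ B : Blocks P, markFactor o exCharge B.1 = 1 :=
    Finset.prod_eq_one fun B _ => markFactor_of_card_eq_one o exCharge (card_block_eq_one hP B)
  obtain ⟨h01, h12, h20⟩ := dirac_exCharge_cyclic
  rw [limitTerm, hB]
  simp only [one_mul]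
  have h := sum_kappa_mul_signSum (o _) (blockOf_bijective_of_card hP) formB_chi_ray_example
    h01 h12 h20
  convert h

lemma naiveTerm_of_card_parts {P : Finpartition (Finset.univ : Finset (Fin 3))}
    (hP : P.parts.card = 3) : naiveTerm o exCharge P = 0 :=
  Finset.sum_eq_zero fun G _ => by
    rw [signProd_exCharge _ G _ (by rw [Fintype.card_coe, hP]), mul_zero]

lemma limitTerm_eq_naiveTerm {n b : ℕ} {X : IntersectionData b} (γ : Fin n → Charge X)
    {P : Finpartition (Finset.univ : Finset (Fin n))} (hP : P.parts.card = 1) :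
    limitTerm o γ P = naiveTerm o γ P :=
  Finset.sum_congr rfl fun G _ => by
    have hG := G.card_edgeSet
    rw [Fintype.card_coe] at hG
    have : IsEmpty G.1.edgeSet := Fintype.card_eq_zero_iff.1 (by omega)
    rw [signSum_of_isEmpty]

/-- For `m = 1` there is one vertex and no edge, so the two expressions agree; for `m = 0` each
partition contributes `1` to the limit and `0` to the other. Positivity of the difference only needs
some partition to exist, so the number is left uncomputed. -/
lemma vertexLimit_sub_naiveVertexLimit :
    vertexLimit o exCharge - naiveVertexLimit o exCharge =
      1 / 6 * ((markedPartitions 3 0).card : ℝ) := by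
  have hl : vertexLimit o exCharge = 1 / ((3).factorial : ℝ) *
      ∑ m ∈ Finset.range 2, ∑ P ∈ markedPartitions 3 m, limitTerm o exCharge P := rfl
  have hn : naiveVertexLimit o exCharge = 1 / ((3).factorial : ℝ) *
      ∑ m ∈ Finset.range 2, ∑ P ∈ markedPartitions 3 m, naiveTerm o exCharge P := rfl
  have hcard : ∀ {m} {P : Finpartition (Finset.univ : Finset (Fin 3))},
      P ∈ markedPartitions 3 m → P.parts.card + 2 * m = 3 :=
    fun hP => (Finset.mem_filter.1 hP).2.1
  rw [hl, hn]
  simp only [Finset.sum_range_succ, Finset.sum_range_zero, zero_add]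
  rw [Finset.sum_congr rfl fun P hP => limitTerm_of_card_parts o (hcard hP),
    Finset.sum_congr rfl fun P hP => naiveTerm_of_card_parts o (hcard hP),
    Finset.sum_congr rfl fun P hP => limitTerm_eq_naiveTerm o exCharge
      (by have := hcard hP; omega : P.parts.card = 1)]
  rw [Finset.sum_const, Finset.sum_const_zero, nsmul_eq_mul, ← mul_sub, add_sub_add_right_eq_sub,
    sub_zero, mul_one, show Nat.factorial 3 = 6 from rfl, Nat.cast_ofNat]

lemma markedPartitions_nonempty (n : ℕ) : (markedPartitions n 0).Nonempty :=
  ⟨⊥, by simp +contextual [markedPartitions]⟩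

lemma vertexLimit_ne_naiveVertexLimit : vertexLimit o exCharge ≠ naiveVertexLimit o exCharge := by
  rw [← sub_ne_zero, vertexLimit_sub_naiveVertexLimit]
  have := Finset.card_pos.2 (markedPartitions_nonempty 3)
  positivity

end Naive

end

end D4Completion

theorem mainTheorem2 :
    -- the limit formula, for all charges and all choices of orientations of the edges
    (∀ (o : ∀ V : Type, D4Completion.EdgeOrientation V) (b n : ℕ) (_ : 1 ≤ n)
      (X : D4Completion.IntersectionData b) (γ : Fin n → D4Completion.Charge X),
      Filter.Tendsto (D4Completion.vertexFn o γ) Filter.atTop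
        (nhds (D4Completion.vertexLimit o γ))) ∧
    -- the identity for the coefficients at `x = 0`; the contracted tree on the right can be
    -- obtained from any of the three trees
    (∀ (b n : ℕ) (X : D4Completion.IntersectionData b) (γ : Fin n → D4Completion.Charge X)
      (V E : Fin 3 → Type) [∀ r, Fintype (E r)] (T : ∀ r, D4Completion.OGraph (V r) (E r))
      (u : ∀ r, V r) (c : Fin n → Σ r, V r),
      (∀ r, (T r).IsTree) → Function.Surjective c → ∀ r : Fin 3,
        (D4Completion.hatTree T u 0).treeErr γ c 0 + (D4Completion.hatTree T u 1).treeErr γ c 0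
            - (D4Completion.hatTree T u 2).treeErr γ c 0 =
          -((D4Completion.hatTree T u r).eContract γ c D4Completion.oldEdges)) ∧
    -- the product of signs alone does not give the limit for all charges
    (∀ o : ∀ V : Type, D4Completion.EdgeOrientation V,
      ∃ (b n : ℕ) (X : D4Completion.IntersectionData b) (γ : Fin n → D4Completion.Charge X),
        1 ≤ n ∧ ¬ Filter.Tendsto (D4Completion.vertexFn o γ) Filter.atTop
          (nhds (D4Completion.naiveVertexLimit o γ))) :=
  ⟨fun o _ _ _ _ γ => D4Completion.tendsto_vertexFn o γ,
    fun _ _ _ _ _ _ _ _ _ _ hT hc r => D4Completion.treeErr_hatTree hT hc r,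
    fun o => ⟨2, 3, D4Completion.exData, D4Completion.exCharge, by norm_num, fun h =>
      D4Completion.vertexLimit_ne_naiveVertexLimit o
        (tendsto_nhds_unique (D4Completion.tendsto_vertexFn o _) h)⟩⟩
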